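/- Let $m,l\ge 1$ be integers and $\alpha\ge 0$ real. Let $x_1,\dots,x_m\in(0,\infty)$ be distributed according to the Wishart--Laguerre ensemble, whose joint density is proportional to $\prod_{1\le i<j\le m}(x_i-x_j)^2\prod_{i=1}^m x_i^{\alpha}\mathrm{e}^{-x_i}$. Put $w(x)=x^{\alpha}\mathrm{e}^{-x}$, let $L_k^{(\alpha)}$ be the generalized Laguerre polynomials, write $(k+\alpha)!=\Gamma(k+\alpha+1)$, and set $$K(x,y)=\sqrt{w(x)w(y)}\sum_{k=0}^{m-1}\frac{k!}{(k+\alpha)!}L_k^{(\alpha)}(x)L_k^{(\alpha)}(y),$$ $$L_D(x,y)=-\frac{m!\sqrt{w(x)w(y)}}{2(m-1+\alpha)!}\left(L_m^{(\alpha)}(x)L_{m-1}^{(\alpha)}(y)+L_{m-1}^{(\alpha)}(x)L_m^{(\alpha)}(y)\right).$$ Let $f_1,\dots,f_l$ be real functions, differentiable on $(0,\infty)$, such that for every $S\subseteq\{1,\dots,l\}$, every $r\in\{1,\dots,l\}\setminus S$ and every $i$ the random variables $\prod_{s\in S}f_s(x_i)$ and $x_if_r'(x_i)\prod_{s\in S}f_s(x_i)$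 have finite (absolute) expectation. Let $X_j=\sum_{i=1}^m f_j(x_i)$, $X_j'=\sum_{i=1}^m x_if_j'(x_i)$ and ${\bf X}=\{X_1,\dots,X_l\}$. For random variables $Y_1,\dots,Y_l$ the joint cumulant is $$\kappa(Y_1,\dots,Y_l)=\sum_{\{P_1,\dots,P_s\}}(-1)^{s-1}(s-1)!\prod_{q=1}^s\mathbb{E}\Big[\prod_{j\in P_q}Y_j\Big],$$ the sum being over all set partitions of $\{1,\dots,l\}$. Define the decoupled integral $$D_l({\bf X})=\sum_{\{p_1,\dots,p_i\}}(-1)^{i-1}\sum_{\sigma\in C_i}\sum_{v=1}^{i}\int_{[0,\infty)^i}L_D(x_v,x_{\sigma(v)})\prod_{j=1}^{i}\prod_{s\in p_j}f_s(x_j)\prod_{1\le j\ne v\le i}K(x_j,x_{\sigma(j)})\prod_{j=1}^i\mathrm{d}x_j,$$ where the outer sum is over all set partitions of $\{1,\dots,l\}$ and $C_i$ is the set of the $(i-1)!$ permutations of $\{1,\dots,i\}$ that consist of a single cycle through all $i$ elements; define the joint cumulant derivative $$\kappa_l'({\bf X})=\kappa(X_1',X_2,\dots,X_l)+\kappa(X_1,X_2',\dots,X_l)+\dots+\kappa(X_1,\dots,X_{l-1},X_l').$$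 Then all the integrals in $D_l({\bf X})$ converge absolutely, and $$D_l({\bf X})=\kappa_l'({\bf X}).$$ -/

import Mathlib

open MeasureTheory Set

noncomputable section

namespace WishartLaguerre

/-- The Laguerre weight `w(x) = x ^ α * e ^ (-x)`. -/
def weight (α x : ℝ) : ℝ := x ^ α * Real.exp (-x)

/-- The generalized Laguerre polynomial
`L_n^{(α)}(x) = ∑_{k ≤ n} (-1)^k * binom (n + α) (n - k) * x ^ k / k!`, for `α > -1`. -/
def laguerre (α : ℝ) (n : ℕ) (x : ℝ) : ℝ :=
  ∑ k ∈ Finset.range (n + 1),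
    (-1) ^ k * (Real.Gamma (n + α + 1) /
      (Real.Gamma (k + α + 1) * (n - k).factorial)) * (x ^ k / k.factorial)

/-- The correlation kernel `K(x, y)` of the Wishart-Laguerre ensemble with `m` eigenvalues;
`(k + α)!` is `Γ(k + α + 1)`. -/
def kernel (m : ℕ) (α x y : ℝ) : ℝ :=
  √(weight α x * weight α y) *
    ∑ k ∈ Finset.range m,
      (k.factorial : ℝ) / Real.Gamma (k + α + 1) * laguerre α k x * laguerre α k y

/-- The symmetric kernel `L_D(x, y)` mixing `L_m` and `L_{m-1}`; `(m - 1 + α)!` is `Γ(m + α)`. -/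
def kernelD (m : ℕ) (α x y : ℝ) : ℝ :=
  -((m.factorial : ℝ) * √(weight α x * weight α y) / (2 * Real.Gamma (m + α))) *
    (laguerre α m x * laguerre α (m - 1) y + laguerre α (m - 1) x * laguerre α m y)

/-- The unnormalized joint density of the eigenvalues `x_1, …, x_m`. -/
def density (m : ℕ) (α : ℝ) (x : Fin m → ℝ) : ℝ :=
  (∏ i, ∏ j ∈ Finset.Ioi i, (x i - x j) ^ 2) * ∏ i, weight α (x i)

/-- The unnormalized eigenvalue measure on `(0, ∞)^m`. -/
def unnormalized (m : ℕ) (α : ℝ) : Measure (Fin m → ℝ) :=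
  (volume.restrict (univ.pi fun _ => Ioi (0 : ℝ))).withDensity
    fun x => ENNReal.ofReal (density m α x)

/-- The Wishart-Laguerre ensemble: the probability measure on `(0, ∞)^m` whose density is
proportional to `∏_{i<j} (x_i - x_j)² ∏_i x_i ^ α * e ^ (-x_i)`. -/
def ensemble (m : ℕ) (α : ℝ) : Measure (Fin m → ℝ) :=
  (unnormalized m α univ)⁻¹ • unnormalized m α

/-- The linear statistic `X = ∑_i f(x_i)`. -/
def linearStat (m : ℕ) (f : ℝ → ℝ) (x : Fin m → ℝ) : ℝ := ∑ i, f (x i)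

/-- The joint cumulant of `l` random variables,
`κ(X_1, …, X_l) = ∑_π (-1)^(|π| - 1) * (|π| - 1)! * ∏_{B ∈ π} 𝔼[∏_{j ∈ B} X_j]`,
the sum being over the set partitions `π` of `{1, …, l}`. -/
def jointCumulant {Ω : Type*} [MeasurableSpace Ω] (μ : Measure Ω) {l : ℕ}
    (X : Fin l → Ω → ℝ) : ℝ :=
  ∑ π : Finpartition (Finset.univ : Finset (Fin l)),
    (-1) ^ (π.parts.card - 1) * ((π.parts.card - 1).factorial : ℝ) *
      ∏ B ∈ π.parts, ∫ ω, ∏ j ∈ B, X j ω ∂μ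

/-- The joint cumulant `κ_l(X_1, …, X_l)` of the linear statistics `X_j = ∑_i f_j(x_i)`. -/
def cumulant (m : ℕ) (α : ℝ) {l : ℕ} (f : Fin l → ℝ → ℝ) : ℝ :=
  jointCumulant (ensemble m α) fun j => linearStat m (f j)

/-- The function `x ↦ x * f'(x)`, which defines the statistic `X' = ∑_i x_i * f'(x_i)`. -/
def eulerDeriv (f : ℝ → ℝ) (x : ℝ) : ℝ := x * deriv f x

/-- The joint cumulant derivative
`κ'_l(X) = κ(X_1', X_2, …, X_l) + … + κ(X_1, …, X_{l-1}, X_l')`. -/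
def cumulantDeriv (m : ℕ) (α : ℝ) {l : ℕ} (f : Fin l → ℝ → ℝ) : ℝ :=
  ∑ j, cumulant m α (Function.update f j (eulerDeriv (f j)))

/-- The integrand of a decoupled integral, for a partition `π` of `{1, …, l}`, a permutation `σ`
of the blocks of `π` and a block `v`. There is one variable `x_p` for each block `p`. -/
def decoupledIntegrand (K L : ℝ → ℝ → ℝ) {l : ℕ} (f : Fin l → ℝ → ℝ)
    (π : Finpartition (Finset.univ : Finset (Fin l))) (σ : Equiv.Perm π.parts) (v : π.parts)
    (x : π.parts → ℝ) : ℝ :=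
  L (x v) (x (σ v)) * (∏ p : π.parts, ∏ s ∈ p.1, f s (x p)) *
    ∏ p ∈ Finset.univ.erase v, K (x p) (x (σ p))

open Classical in
/-- The decoupled integral with kernels `K` and `L`: the sum over the partitions `π` of
`{1, …, l}` with sign `(-1)^(|π| - 1)`, over the cyclic permutations `σ` of all the blocks of `π`
(a single cycle through all of them) and over the blocks `v` at which `K` is replaced by `L`. -/
def decoupledIntegral (K L : ℝ → ℝ → ℝ) {l : ℕ} (f : Fin l → ℝ → ℝ) : ℝ :=
  ∑ π : Finpartition (Finset.univ : Finset (Fin l)),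
    (-1) ^ (π.parts.card - 1) *
      ∑ σ : Equiv.Perm π.parts with σ.IsCycleOn univ, ∑ v : π.parts,
        ∫ x in univ.pi fun _ : π.parts => Ioi (0 : ℝ), decoupledIntegrand K L f π σ v x

end WishartLaguerre

end

/-! Both sides are two expansions of one logarithmic derivative of a determinant. Let `phi a` be the
Laguerre functions `√w L_a` and `psi a` the dual system, so that `K(x,y) = ∑_{c<m} phi_c(x)
psi_c(y)`. For nonempty `S` let `N_S` be the matrix of the integrals `∫ (∏_{s∈S} f_s) psi_a phi_b`,
with `0 ≤ a,b ≤ m`, and put `N = ∑_S N_S t^S` with formal variables `t_1,…,t_l`. Only squarefree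
coefficients are ever read, so each `f_s` occurs at most once. With `E` the inclusion of the first
`m` coordinates and `P = E Eᵀ`, Andréief's identity makes the joint moments the coefficients of `det
G`, where `G = 1 + Eᵀ N E` (`integral_prod_linearStat`). Replacing one `f_j` at a time by `x f_j'`
and summing over `j` acts on these coefficients as a derivation (`IsVariation.det`). The operator
`2x d/dx + 1` is antisymmetric and tridiagonal in the Laguerre functions, with matrix `B`, so
integration by parts gives the variation of `G` as `½ Eᵀ[N,B]E` (`integral_euler_mul_psi_mul_phi`).
Hence everything is contained in `q = tr(G⁻¹ · ½ Eᵀ[N,B]E)`. Scalar expansion: `det G · q` generates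
the varied moments. Solving for `q` recursively gives a sum over ordered partitions, in which the
orders of the remaining blocks contribute `(|π|-1)!`; this is the cumulant derivative. Matrix
expansion: `q = tr(½[B,P] X)`, where `X = N - N P X` (`resolvent_identities`). Iterating yields
alternating sums of `tr(½[B,P] N_{T_0} P ⋯ P N_{T_k})`. Here `P` encodes `K`, and `½[B,P]`, which
has only two nonzero entries, encodes `L_D = -(x∂_x + y∂_y + 1)K`. Each trace is an integral over a
cycle of kernels cut open at the marked block, and a cycle with a marked block is a linear order of
the blocks (`sum_isCycleOn`). Convergence has two sources. The one-point marginal of the ensemble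
dominates each density `psi_a phi_a`, `a < m`, which gives integrability against products of two
such Laguerre functions. A Hardy type inequality then gains one more degree, reaching all pairs
`(a,b)` except `(m,m)`, which is never needed. -/

noncomputable section

namespace WishartLaguerre

/-! ### Ordered set partitions and linear recursions over subsets. -/

section OrderedPartitions

variable {ι : Type*} [Fintype ι] [DecidableEq ι] {A : Type*} [Ring A]

/-- The ordered partitions of `S` into `k` nonempty blocks. -/
def orderedPartitions (k : ℕ) (S : Finset ι) : Finset (Fin k → Finset ι) :=
  {T | (∀ i, (T i).Nonempty) ∧ (∀ i j, i ≠ j → Disjoint (T i) (T j)) ∧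
    Finset.univ.biUnion T = S}

/-- The product `n (T 0) * ⋯ * n (T (k - 1)) * r (T k)`. -/
def chainProd (n r : Finset ι → A) : (k : ℕ) → (Fin (k + 1) → Finset ι) → A
  | 0, T => r (T 0)
  | k + 1, T => n (T 0) * chainProd n r k (Fin.tail T)

lemma mem_orderedPartitions {k : ℕ} {S : Finset ι} {T : Fin k → Finset ι} :
    T ∈ orderedPartitions k S ↔ (∀ i, (T i).Nonempty) ∧ (∀ i j, i ≠ j → Disjoint (T i) (T j)) ∧
      Finset.univ.biUnion T = S := by
  simp [orderedPartitions]

lemma cons_mem_orderedPartitions {k : ℕ} {S B : Finset ι} {T : Fin k → Finset ι} :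
    (Fin.cons B T : Fin (k + 1) → Finset ι) ∈ orderedPartitions (k + 1) S ↔
      (B ⊆ S ∧ B.Nonempty) ∧ T ∈ orderedPartitions k (S \ B) := by
  simp only [mem_orderedPartitions, Fin.forall_fin_succ, Fin.cons_zero, Fin.cons_succ]
  constructor
  · rintro ⟨⟨hB, hT⟩, ⟨⟨-, h0⟩, h1⟩, hu⟩
    have hu' : B ∪ Finset.univ.biUnion T = S := by
      rw [← hu]; ext x; simp [Fin.exists_fin_succ]
    have hd : Disjoint B (Finset.univ.biUnion T) := by
      rw [Finset.disjoint_biUnion_right]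
      intro i _
      exact h0 i (Fin.succ_ne_zero i).symm
    refine ⟨⟨?_, hB⟩, hT, ?_, ?_⟩
    · rw [← hu']; exact Finset.subset_union_left
    · intro i j hij
      exact (h1 i).2 j (fun h => hij (Fin.succ_injective _ h))
    · rw [← hu', Finset.union_sdiff_cancel_left hd]
  · rintro ⟨⟨hBS, hB⟩, hT, h1, hu⟩
    have h0 : ∀ i, Disjoint B (T i) := by
      intro i
      have : T i ⊆ S \ B := by
        rw [← hu]; exact Finset.subset_biUnion_of_mem T (Finset.mem_univ i)
      exact (Finset.disjoint_sdiff).mono_right this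
    refine ⟨⟨hB, hT⟩, ⟨⟨fun h => absurd rfl h, fun i _ => h0 i⟩, fun i => ⟨fun _ => (h0 i).symm, ?_⟩⟩, ?_⟩
    · intro j hij
      exact h1 i j (fun h => hij (by rw [h]))
    · have : Finset.univ.biUnion (Fin.cons B T : Fin (k + 1) → Finset ι)
          = B ∪ Finset.univ.biUnion T := by
        ext x; simp [Fin.exists_fin_succ]
      rw [this, hu, Finset.union_sdiff_of_subset hBS]

/-- Peeling off the first block matches the recursion for `chainProd`, and so drives the induction
in `eq_sum_chainProd`. -/
lemma sum_orderedPartitions_succ {M : Type*} [AddCommMonoid M] (k : ℕ) (S : Finset ι)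
    (Φ : (Fin (k + 1) → Finset ι) → M) :
    ∑ T ∈ orderedPartitions (k + 1) S, Φ T =
      ∑ B ∈ S.powerset with B.Nonempty, ∑ T ∈ orderedPartitions k (S \ B), Φ (Fin.cons B T) := by
  rw [Finset.sum_sigma']
  refine Finset.sum_bij' (fun T _ => ⟨T 0, Fin.tail T⟩) (fun p _ => Fin.cons p.1 p.2) ?_ ?_ ?_ ?_ ?_
  · intro T hT
    rw [← Fin.cons_self_tail T, cons_mem_orderedPartitions] at hT
    simpa using hT
  · rintro ⟨B, T⟩ h
    rw [cons_mem_orderedPartitions]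
    simpa using h
  · intro T _
    exact Fin.cons_self_tail T
  · rintro ⟨B, T⟩ _
    simp
  · intro T _
    simp

lemma orderedPartitions_zero (S : Finset ι) :
    orderedPartitions 0 S = if S = ∅ then Finset.univ else ∅ := by
  ext T
  rw [mem_orderedPartitions]
  split_ifs with h
  · simpa [h] using Subsingleton.elim _ _
  · simp [Ne.symm h]

lemma sum_chainProd_zero (n r : Finset ι → A) (hr : r ∅ = 0) (S : Finset ι) :
    ∑ T ∈ orderedPartitions 1 S, chainProd n r 0 T = r S := by
  rw [sum_orderedPartitions_succ]
  simp only [orderedPartitions_zero, Finset.sdiff_eq_empty_iff_subset, chainProd, Fin.cons_zero]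
  rcases S.eq_empty_or_nonempty with rfl | hS
  · rw [hr]
    apply Finset.sum_eq_zero
    intro B hB
    simp only [Finset.mem_filter, Finset.mem_powerset, Finset.subset_empty] at hB
    exact absurd hB.1 hB.2.ne_empty
  · rw [Finset.sum_eq_single S]
    · simp
    · intro B hB hne
      simp only [Finset.mem_filter, Finset.mem_powerset] at hB
      rw [if_neg (fun h => hne (hB.1.antisymm h))]
      simp
    · simp [hS]

/-- The solution of the linear recursion `q S = r S - ∑_{T ⊆ S} n T * q (S \ T)`. -/
theorem eq_sum_chainProd {n r q : Finset ι → A} (hn : n ∅ = 0) (hr : r ∅ = 0)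
    (hq : ∀ S, q S = r S - ∑ T ∈ S.powerset, n T * q (S \ T)) (N : ℕ) (S : Finset ι)
    (hS : S.card ≤ N) :
    q S = ∑ k ∈ Finset.range N, (-1) ^ k *
      ∑ T ∈ orderedPartitions (k + 1) S, chainProd n r k T := by
  induction N generalizing S with
  | zero =>
    have : S = ∅ := by simpa using hS
    subst this
    rw [hq]
    simp [hn, hr]
  | succ N ih =>
    rw [Finset.sum_range_succ', hq]
    simp only [pow_zero, one_mul]
    rw [sum_chainProd_zero n r hr, sub_eq_neg_add]
    congr 1
    -- The term `T = ∅` would reproduce `q S` itself; `n ∅ = 0` removes it, so the recursion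
    -- strictly lowers the cardinality.
    have h1 : ∑ T ∈ S.powerset, n T * q (S \ T) =
        ∑ T ∈ S.powerset with T.Nonempty, n T * q (S \ T) := by
      rw [Finset.sum_filter]
      refine Finset.sum_congr rfl fun T _ => ?_
      split_ifs with h
      · rfl
      · rw [Finset.not_nonempty_iff_eq_empty.1 h, hn, zero_mul]
    rw [h1]
    have h2 : ∀ T ∈ S.powerset.filter (·.Nonempty), n T * q (S \ T) =
        ∑ k ∈ Finset.range N, (-1) ^ k * ∑ T' ∈ orderedPartitions (k + 1) (S \ T),
          chainProd n r (k + 1) (Fin.cons T T') := by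
      intro T hT
      simp only [Finset.mem_filter, Finset.mem_powerset] at hT
      rw [ih (S \ T), Finset.mul_sum]
      · refine Finset.sum_congr rfl fun k _ => ?_
        simp only [chainProd, Fin.cons_zero, Fin.tail_cons]
        rw [← Finset.mul_sum, ← mul_assoc, ← mul_assoc,
          ((Commute.neg_one_left (n T)).pow_left k).eq]
      · have := Finset.card_sdiff_add_card_eq_card hT.1
        have := hT.2.card_pos
        omega
    rw [Finset.sum_congr rfl h2, Finset.sum_comm, ← Finset.sum_neg_distrib]
    refine Finset.sum_congr rfl fun k _ => ?_
    rw [sum_orderedPartitions_succ, ← Finset.mul_sum, pow_succ]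
    simp

/-- An ordered partition is a partition with an enumeration of its blocks: nonempty disjoint blocks
are distinct, so the family is injective. -/
lemma sum_orderedPartitions_univ {M : Type*} [AddCommMonoid M] (k : ℕ)
    (Φ : (Fin k → Finset ι) → M) :
    ∑ T ∈ orderedPartitions k (Finset.univ : Finset ι), Φ T =
      ∑ π : Finpartition (Finset.univ : Finset ι), ∑ e : Fin k ≃ π.parts,
        Φ fun i => (e i).1 := by
  rw [Finset.sum_sigma']
  symm
  refine Finset.sum_bij (fun p _ i => (p.2 i).1) ?_ ?_ ?_ ?_
  · rintro ⟨π, e⟩ _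
    rw [mem_orderedPartitions]
    refine ⟨fun i => π.nonempty_of_mem_parts (e i).2, fun i j hij => ?_, ?_⟩
    · exact π.disjoint (e i).2 (e j).2 (fun h => hij (e.injective (Subtype.ext h)))
    · ext x
      simp only [Finset.mem_biUnion, Finset.mem_univ, true_and, iff_true]
      refine ⟨e.symm ⟨π.part x, π.part_mem.2 (Finset.mem_univ x)⟩, ?_⟩
      simp [π.mem_part]
  · rintro ⟨π, e⟩ _ ⟨π', e'⟩ _ h
    have h' : ∀ i, (e i).1 = (e' i).1 := fun i => congrFun h i
    have hp : π = π' := by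
      ext B
      constructor
      · intro hB
        have := h' (e.symm ⟨B, hB⟩)
        rw [Equiv.apply_symm_apply] at this
        simp only at this
        rw [this]; exact (e' _).2
      · intro hB
        have := h' (e'.symm ⟨B, hB⟩)
        rw [Equiv.apply_symm_apply] at this
        simp only at this
        rw [← this]; exact (e _).2
    subst hp
    congr 1
    exact Equiv.ext fun i => Subtype.ext (h' i)
  · intro T hT
    rw [mem_orderedPartitions] at hT
    obtain ⟨hne, hd, hu⟩ := hT
    have hinj : Function.Injective T := by
      intro i j hij
      by_contra hc
      have := hd i j hc
      rw [hij, disjoint_self] at this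
      exact (hne j).ne_empty this
    let π : Finpartition (Finset.univ : Finset ι) :=
      { parts := Finset.univ.image T
        supIndep := by
          rw [Finset.supIndep_iff_pairwiseDisjoint]
          rintro _ hi _ hj hij
          simp only [Finset.coe_image, Finset.coe_univ, Set.image_univ, Set.mem_range] at hi hj
          obtain ⟨i, rfl⟩ := hi
          obtain ⟨j, rfl⟩ := hj
          exact hd i j (fun h => hij (by rw [h]))
        sup_parts := by
          rw [← hu, Finset.sup_image, Finset.sup_eq_biUnion]; rfl
        bot_notMem := by
          simp only [Finset.bot_eq_empty, Finset.mem_image, Finset.mem_univ, true_and, not_exists]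
          exact fun i => (hne i).ne_empty }
    have hmem : ∀ i, T i ∈ π.parts := fun i => Finset.mem_image_of_mem _ (Finset.mem_univ i)
    refine ⟨⟨π, Equiv.ofBijective (fun i => ⟨T i, hmem i⟩) ⟨?_, ?_⟩⟩, by simp, rfl⟩
    · intro i j h
      exact hinj (congrArg Subtype.val h)
    · rintro ⟨B, hB⟩
      obtain ⟨i, -, rfl⟩ := Finset.mem_image.1 hB
      exact ⟨i, rfl⟩
  · intros; rfl

lemma parts_card_pos [Nonempty ι] (π : Finpartition (Finset.univ : Finset ι)) :
    0 < π.parts.card :=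
  Finset.card_pos.2 (π.parts_nonempty Finset.univ_nonempty.ne_empty)

/-- The recursion solved at the full set, as a sum over set partitions and orderings. -/
theorem eq_sum_finpartition [Nonempty ι] {n r q : Finset ι → A} (hn : n ∅ = 0) (hr : r ∅ = 0)
    (hq : ∀ S, q S = r S - ∑ T ∈ S.powerset, n T * q (S \ T)) :
    q Finset.univ = ∑ π : Finpartition (Finset.univ : Finset ι), (-1) ^ (π.parts.card - 1) *
      ∑ e : Fin (π.parts.card - 1 + 1) ≃ π.parts,
        chainProd n r (π.parts.card - 1) fun i => (e i).1 := by
  rw [eq_sum_chainProd hn hr hq (Fintype.card ι) _ le_rfl]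
  simp only [sum_orderedPartitions_univ, Finset.mul_sum]
  rw [Finset.sum_comm]
  refine Finset.sum_congr rfl fun π _ => ?_
  have hpos := parts_card_pos π
  have hle : π.parts.card ≤ Fintype.card ι := π.card_parts_le_card
  -- Enumerations by `Fin (k + 1)` exist only if `k + 1` is the number of blocks.
  rw [Finset.sum_eq_single (π.parts.card - 1)]
  · intro k _ hk
    have : IsEmpty (Fin (k + 1) ≃ π.parts) := by
      refine ⟨fun e => hk ?_⟩
      have := Fintype.card_congr e
      simp at this
      omega
    simp
  · intro h
    simp only [Finset.mem_range, not_lt] at h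
    omega

end OrderedPartitions

/-! ### Linear orders with a distinguished end, and cyclic permutations. -/

section CyclicOrders

variable {P : Type*}

/-- Every element is last in `k!` orders. Reversal moves the last place to `0`, where
`Equiv.Perm.decomposeFin` splits off its value. -/
lemma sum_equiv_apply_last [Fintype P] [DecidableEq P] {k : ℕ} (hP : Fintype.card P = k + 1) {A : Type*} [CommRing A]
    (g : P → A) :
    ∑ e : Fin (k + 1) ≃ P, g (e (Fin.last k)) = (k.factorial : A) * ∑ B, g B := by
  let e₀ : Fin (k + 1) ≃ P := (Fintype.equivFinOfCardEq hP).symm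
  rw [← Equiv.sum_comp (Equiv.equivCongr Fin.revPerm e₀) (fun e => g (e (Fin.last k)))]
  simp only [Equiv.equivCongr_apply_apply, Fin.revPerm_symm, Fin.revPerm_apply, Fin.rev_last]
  rw [← Equiv.sum_comp Equiv.Perm.decomposeFin.symm]
  rw [Fintype.sum_prod_type]
  simp only [Equiv.Perm.decomposeFin_symm_apply_zero, Finset.sum_const, Finset.card_univ,
    Fintype.card_perm, Fintype.card_fin, nsmul_eq_mul]
  rw [← Finset.mul_sum, Equiv.sum_comp e₀ g]

lemma chainProd_eq {ι : Type*} {A : Type*} [CommRing A] (n r : Finset ι → A) (k : ℕ)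
    (T : Fin (k + 1) → Finset ι) :
    chainProd n r k T = (∏ i : Fin k, n (T i.castSucc)) * r (T (Fin.last k)) := by
  induction k with
  | zero => simp [chainProd]
  | succ k ih =>
    rw [chainProd, ih, Fin.prod_univ_succ, ← mul_assoc]
    rfl

/-- Over a commutative ring a chain depends only on its final block; this is the source of the
factor `(|π| - 1)!` in the cumulants. -/
lemma sum_chainProd_equiv {ι : Type*} [DecidableEq ι] {A : Type*} [CommRing A]
    (n r : Finset ι → A) (p : Finset (Finset ι)) (k : ℕ) (hp : p.card = k + 1) :
    ∑ e : Fin (k + 1) ≃ p, chainProd n r k (fun i => (e i).1) =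
      (k.factorial : A) * ∑ B ∈ p, r B * ∏ C ∈ p.erase B, n C := by
  have h1 : ∀ e : Fin (k + 1) ≃ p, chainProd n r k (fun i => (e i).1) =
      r (e (Fin.last k)).1 * ∏ C ∈ p.erase (e (Fin.last k)).1, n C := by
    intro e
    rw [chainProd_eq, mul_comm]
    congr 1
    refine Finset.prod_bij (fun i _ => (e i.castSucc).1) ?_ ?_ ?_ ?_
    · intro i _
      rw [Finset.mem_erase]
      refine ⟨fun h => ?_, (e i.castSucc).2⟩
      exact (Fin.castSucc_lt_last i).ne (e.injective (Subtype.ext h))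
    · intro i _ j _ h
      exact Fin.castSucc_injective _ (e.injective (Subtype.ext h))
    · intro C hC
      rw [Finset.mem_erase] at hC
      have hne : e.symm ⟨C, hC.2⟩ ≠ Fin.last k := by
        intro h
        apply hC.1
        rw [← h, Equiv.apply_symm_apply]
      refine ⟨(e.symm ⟨C, hC.2⟩).castPred hne, Finset.mem_univ _, ?_⟩
      simp
    · intros; rfl
  rw [Finset.sum_congr rfl fun e _ => h1 e,
    sum_equiv_apply_last (by simpa using hp)
      (fun B : p => r B.1 * ∏ C ∈ p.erase B.1, n C)]
  congr 1
  exact Finset.sum_coe_sort p (fun B => r B * ∏ C ∈ p.erase B, n C)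

/-- The cyclic permutation `e 0 → e 1 → ⋯ → e k → e 0`. -/
def cycleOf {k : ℕ} (e : Fin (k + 1) ≃ P) : Equiv.Perm P :=
  e.symm.trans ((finRotate (k + 1)).trans e)

lemma cycleOf_apply {k : ℕ} (e : Fin (k + 1) ≃ P) (i : Fin (k + 1)) :
    cycleOf e (e i) = e (i + 1) := by
  simp [cycleOf]

lemma cycleOf_pow_apply {k : ℕ} (e : Fin (k + 1) ≃ P) (i : Fin (k + 1)) (n : ℕ) :
    (cycleOf e ^ n) (e i) = e (i + Fin.ofNat (k + 1) n) := by
  induction n with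
  | zero => simp
  | succ n ih =>
    rw [pow_succ', Equiv.Perm.mul_apply, ih, cycleOf_apply, add_assoc]
    congr 2
    ext
    simp [Fin.val_add]

lemma isCycleOn_cycleOf {k : ℕ} (e : Fin (k + 1) ≃ P) : (cycleOf e).IsCycleOn univ := by
  refine ⟨(cycleOf e).bijective.bijOn_univ, fun x _ y _ => ?_⟩
  refine ⟨((e.symm y - e.symm x : Fin (k + 1)).val : ℤ), ?_⟩
  rw [zpow_natCast]
  conv_lhs => rw [← e.apply_symm_apply x]
  rw [cycleOf_pow_apply, Fin.ofNat_val_eq_self]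
  simp

/-- Follow the cycle from the successor of `v`: the order `i ↦ σ^(i+1) v` exhausts `P` and comes
back to `v` at `i = k`. -/
lemma exists_cycleOf_eq [Fintype P] {k : ℕ} (hP : Fintype.card P = k + 1) {σ : Equiv.Perm P}
    (hσ : σ.IsCycleOn univ) (v : P) :
    ∃ e : Fin (k + 1) ≃ P, cycleOf e = σ ∧ e (Fin.last k) = v := by
  have hσ' : σ.IsCycleOn ((Finset.univ : Finset P) : Set P) := by simpa using hσ
  have hc : (σ ^ (k + 1)) v = v := by
    have := hσ'.pow_card_apply (Finset.mem_univ v)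
    rwa [Finset.card_univ, hP] at this
  let f : Fin (k + 1) → P := fun i => (σ ^ (i.val + 1)) v
  have hf : Function.Surjective f := by
    intro y
    obtain ⟨n, hn, h⟩ := hσ'.exists_pow_eq (Finset.mem_univ v) (Finset.mem_univ (σ⁻¹ y))
    rw [Finset.card_univ, hP] at hn
    refine ⟨⟨n, hn⟩, ?_⟩
    simp only [f]
    rw [pow_succ', Equiv.Perm.mul_apply, h]
    simp
  have hbij : Function.Bijective f :=
    (Fintype.bijective_iff_surjective_and_card f).2 ⟨hf, by simp [hP]⟩
  let e := Equiv.ofBijective f hbij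
  have hlast : e (Fin.last k) = v := hc
  refine ⟨e, ?_, hlast⟩
  ext x
  obtain ⟨i, rfl⟩ := e.surjective x
  rw [cycleOf_apply]
  change f (i + 1) = σ (f i)
  by_cases hi : i = Fin.last k
  · subst hi
    rw [Fin.last_add_one]
    simp only [f, Fin.val_zero, zero_add, pow_one, Fin.val_last]
    rw [hc]
  · simp only [f]
    rw [Fin.val_add_one_of_lt (Fin.lt_last_iff_ne_last.2 hi), pow_succ' σ (i.val + 1)]
    rfl

open Classical in
/-- A cyclic permutation with a marked point is a linear order ending at that point. -/
theorem sum_isCycleOn [Fintype P] [DecidableEq P] {k : ℕ} (hP : Fintype.card P = k + 1) {M : Type*} [AddCommMonoid M]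
    (Ψ : Equiv.Perm P → P → M) :
    ∑ σ : Equiv.Perm P with σ.IsCycleOn univ, ∑ v, Ψ σ v =
      ∑ e : Fin (k + 1) ≃ P, Ψ (cycleOf e) (e (Fin.last k)) := by
  rw [← Finset.sum_product']
  symm
  refine Finset.sum_bij (fun e _ => (cycleOf e, e (Fin.last k))) ?_ ?_ ?_ ?_
  · intro e _
    simpa using isCycleOn_cycleOf e
  · intro e _ e' _ h
    simp only [Prod.mk.injEq] at h
    ext i
    have h1 := cycleOf_pow_apply e (Fin.last k) (i - Fin.last k).val
    have h2 := cycleOf_pow_apply e' (Fin.last k) (i - Fin.last k).val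
    rw [h.1, h.2, h2, Fin.ofNat_val_eq_self] at h1
    simpa using h1.symm
  · rintro ⟨σ, v⟩ h
    simp only [Finset.mem_product, Finset.mem_filter, Finset.mem_univ, true_and, and_true] at h
    obtain ⟨e, h1, h2⟩ := exists_cycleOf_eq hP h v
    exact ⟨e, Finset.mem_univ _, by rw [h1, h2]⟩
  · intros; rfl

end CyclicOrders

/-! ### Squarefree coefficients of power series and their first variation. -/

section SquarefreeCoefficients

variable {ι : Type*}

/-- The exponent of the squarefree monomial `∏ i ∈ S, t i`. -/
def sqfreeExp (S : Finset ι) : ι →₀ ℕ := Finsupp.indicator S fun _ _ => 1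

lemma sqfreeExp_apply [DecidableEq ι] (S : Finset ι) (i : ι) :
    sqfreeExp S i = if i ∈ S then 1 else 0 := by
  simp [sqfreeExp, Finsupp.indicator_apply]

lemma sqfreeExp_support [DecidableEq ι] (S : Finset ι) : (sqfreeExp S).support = S := by
  ext i; simp [sqfreeExp_apply]

/-- The coefficient of the squarefree monomial `∏ i ∈ S, t i`. -/
def sqfreeCoeff (S : Finset ι) : MvPowerSeries ι ℝ →ₗ[ℝ] ℝ := MvPowerSeries.coeff (sqfreeExp S)

/-- The power series `∑ S, g S * ∏ i ∈ S, t i`. -/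
def sqfreeSeries [DecidableEq ι] (g : Finset ι → ℝ) : MvPowerSeries ι ℝ :=
  fun d => if d = sqfreeExp d.support then g d.support else 0

lemma coeff_sqfreeSeries [DecidableEq ι] (g : Finset ι → ℝ) (d : ι →₀ ℕ) :
    MvPowerSeries.coeff d (sqfreeSeries g) =
      if d = sqfreeExp d.support then g d.support else 0 := rfl

@[simp] lemma sqfreeCoeff_sqfreeSeries [DecidableEq ι] (g : Finset ι → ℝ) (S : Finset ι) :
    sqfreeCoeff S (sqfreeSeries g) = g S := by
  rw [sqfreeCoeff, coeff_sqfreeSeries, sqfreeExp_support, if_pos rfl]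

lemma sqfreeExp_empty [DecidableEq ι] : sqfreeExp (∅ : Finset ι) = 0 := by
  ext i; simp [sqfreeExp_apply]

lemma sqfreeCoeff_empty [DecidableEq ι] (p : MvPowerSeries ι ℝ) :
    sqfreeCoeff ∅ p = MvPowerSeries.constantCoeff p := by
  rw [sqfreeCoeff, sqfreeExp_empty, MvPowerSeries.coeff_zero_eq_constantCoeff]

lemma sqfreeCoeff_one [DecidableEq ι] (S : Finset ι) :
    sqfreeCoeff S (1 : MvPowerSeries ι ℝ) = if S = ∅ then 1 else 0 := by
  rw [sqfreeCoeff, MvPowerSeries.coeff_one]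
  congr 1
  rw [← sqfreeExp_empty, eq_iff_iff]
  refine ⟨fun h => ?_, fun h => by rw [h]⟩
  rw [← sqfreeExp_support S, h, sqfreeExp_support]

/-- Two exponents adding up to a 0/1 vector are 0/1 vectors with complementary supports, so the
convolution involves squarefree coefficients only. -/
lemma sqfreeCoeff_mul [DecidableEq ι] (S : Finset ι) (p q : MvPowerSeries ι ℝ) :
    sqfreeCoeff S (p * q) = ∑ T ∈ S.powerset, sqfreeCoeff T p * sqfreeCoeff (S \ T) q := by
  rw [sqfreeCoeff, MvPowerSeries.coeff_mul]
  symm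
  refine Finset.sum_bij (fun T _ => (sqfreeExp T, sqfreeExp (S \ T))) ?_ ?_ ?_ ?_
  · intro T hT
    rw [Finset.mem_powerset] at hT
    rw [Finset.HasAntidiagonal.mem_antidiagonal]
    ext i
    simp only [Finsupp.add_apply, sqfreeExp_apply, Finset.mem_sdiff]
    by_cases h1 : i ∈ T
    · simp [h1, hT h1]
    · simp [h1]
  · intro T _ T' _ h
    rw [← sqfreeExp_support T, (Prod.mk.inj h).1, sqfreeExp_support]
  · rintro ⟨d, d'⟩ h
    rw [Finset.HasAntidiagonal.mem_antidiagonal] at h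
    have hi : ∀ i, d i + d' i = if i ∈ S then 1 else 0 := by
      intro i
      rw [← sqfreeExp_apply, ← h, Finsupp.add_apply]
    refine ⟨d.support, ?_, ?_⟩
    · rw [Finset.mem_powerset]
      intro i hd
      rw [Finsupp.mem_support_iff] at hd
      by_contra hS
      have := hi i
      rw [if_neg hS] at this
      omega
    · refine Prod.ext ?_ ?_
      · ext i
        simp only [sqfreeExp_apply, Finsupp.mem_support_iff]
        have := hi i
        split_ifs at this ⊢ <;> omega
      · ext i
        simp only [sqfreeExp_apply, Finset.mem_sdiff, Finsupp.mem_support_iff]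
        have := hi i
        by_cases hS : i ∈ S <;> by_cases hd : d i = 0 <;> simp [hS, hd] at this ⊢ <;> omega
  · intros; rfl

/-- `pj j` varies the `j`-th variable of `p`, and `p'` is the total variation. -/
structure IsVariation (p : MvPowerSeries ι ℝ) (pj : ι → MvPowerSeries ι ℝ)
    (p' : MvPowerSeries ι ℝ) : Prop where
  eq_of_notMem : ∀ T j, j ∉ T → sqfreeCoeff T (pj j) = sqfreeCoeff T p
  eq_sum : ∀ T, sqfreeCoeff T p' = ∑ j ∈ T, sqfreeCoeff T (pj j)

lemma IsVariation.one [DecidableEq ι] : IsVariation (1 : MvPowerSeries ι ℝ) (fun _ => 1) 0 := by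
  refine ⟨fun _ _ _ => rfl, fun T => ?_⟩
  rw [map_zero, sqfreeCoeff_one]
  split_ifs with h <;> simp [h]

/-- Leibniz rule: when `S` splits into `T` and `S \ T`, each `j ∈ S` lies in exactly one part, so
only that factor feels the variation of `j`. -/
lemma IsVariation.mul [DecidableEq ι] {p p' q q' : MvPowerSeries ι ℝ} {pj qj :
    ι → MvPowerSeries ι ℝ}
    (hp : IsVariation p pj p') (hq : IsVariation q qj q') :
    IsVariation (p * q) (fun j => pj j * qj j) (p' * q + p * q') := by
  refine ⟨fun S j hj => ?_, fun S => ?_⟩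
  · rw [sqfreeCoeff_mul, sqfreeCoeff_mul]
    refine Finset.sum_congr rfl fun T hT => ?_
    rw [Finset.mem_powerset] at hT
    rw [hp.eq_of_notMem T j (fun h => hj (hT h)),
      hq.eq_of_notMem (S \ T) j (fun h => hj (Finset.sdiff_subset h))]
  · simp only [map_add, sqfreeCoeff_mul]
    rw [Finset.sum_comm, ← Finset.sum_add_distrib]
    refine Finset.sum_congr rfl fun T hT => ?_
    rw [Finset.mem_powerset] at hT
    rw [← Finset.sum_sdiff hT, hp.eq_sum, hq.eq_sum, Finset.sum_mul, Finset.mul_sum, add_comm]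
    congr 1
    · refine Finset.sum_congr rfl fun j hj => ?_
      rw [hp.eq_of_notMem T j (Finset.mem_sdiff.1 hj).2]
    · refine Finset.sum_congr rfl fun j hj => ?_
      rw [hq.eq_of_notMem (S \ T) j (fun h => (Finset.mem_sdiff.1 h).2 hj)]

lemma IsVariation.smul {p p' : MvPowerSeries ι ℝ} {pj : ι → MvPowerSeries ι ℝ} (c : ℝ)
    (hp : IsVariation p pj p') : IsVariation (c • p) (fun j => c • pj j) (c • p') := by
  refine ⟨fun T j hj => ?_, fun T => ?_⟩
  · rw [map_smul, map_smul, hp.eq_of_notMem T j hj]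
  · simp only [map_smul, hp.eq_sum, Finset.smul_sum]

lemma IsVariation.sum {κ : Type*} (s : Finset κ) {p p' : κ → MvPowerSeries ι ℝ}
    {pj : κ → ι → MvPowerSeries ι ℝ} (hp : ∀ k, IsVariation (p k) (pj k) (p' k)) :
    IsVariation (∑ k ∈ s, p k) (fun j => ∑ k ∈ s, pj k j) (∑ k ∈ s, p' k) := by
  refine ⟨fun T j hj => ?_, fun T => ?_⟩
  · rw [map_sum, map_sum]
    exact Finset.sum_congr rfl fun k _ => (hp k).eq_of_notMem T j hj
  · simp only [map_sum]
    rw [Finset.sum_comm]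
    exact Finset.sum_congr rfl fun k _ => (hp k).eq_sum T

lemma IsVariation.prod [DecidableEq ι] {κ : Type*} [DecidableEq κ] (s : Finset κ) {p p' :
    κ → MvPowerSeries ι ℝ}
    {pj : κ → ι → MvPowerSeries ι ℝ} (hp : ∀ k, IsVariation (p k) (pj k) (p' k)) :
    IsVariation (∏ k ∈ s, p k) (fun j => ∏ k ∈ s, pj k j)
      (∑ k ∈ s, p' k * ∏ k' ∈ s.erase k, p k') := by
  induction s using Finset.induction_on with
  | empty => simpa using IsVariation.one
  | insert a s ha ih =>
    have h := (hp a).mul ih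
    have e1 : (fun j => ∏ k ∈ insert a s, pj k j) = fun j => pj a j * ∏ k ∈ s, pj k j := by
      funext j; rw [Finset.prod_insert ha]
    rw [Finset.prod_insert ha, e1, Finset.sum_insert ha, Finset.erase_insert ha]
    convert h using 2
    rw [Finset.mul_sum]
    refine Finset.sum_congr rfl fun k hk => ?_
    rw [Finset.erase_insert_of_ne (fun h : a = k => ha (h ▸ hk)), Finset.prod_insert
      (fun h => ha (Finset.mem_of_mem_erase h))]
    ring

/-- By Cramer's rule the trace is the sum of the determinants in which one column of `G` is replaced
by that of `G'`. This is Jacobi's formula in the shape produced by `IsVariation.prod`. -/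
lemma trace_adjugate_mul {n : Type*} [Fintype n] [DecidableEq n] {R : Type*} [CommRing R]
    (G G' : Matrix n n R) :
    (G.adjugate * G').trace = ∑ σ : Equiv.Perm n, (Equiv.Perm.sign σ : ℤ) •
      ∑ i, G' (σ i) i * ∏ k ∈ Finset.univ.erase i, G (σ k) k := by
  have h : (G.adjugate * G').trace = ∑ i, (G.updateCol i fun k => G' k i).det := by
    rw [Matrix.trace]
    refine Finset.sum_congr rfl fun i _ => ?_
    rw [Matrix.diag_apply, ← Matrix.cramer_apply, Matrix.cramer_eq_adjugate_mulVec]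
    rfl
  rw [h]
  simp only [Matrix.det_apply, Finset.smul_sum]
  rw [Finset.sum_comm]
  refine Finset.sum_congr rfl fun σ _ => Finset.sum_congr rfl fun i _ => ?_
  rw [Units.smul_def, ← Finset.mul_prod_erase _ _ (Finset.mem_univ i)]
  congr 2
  · simp
  · refine Finset.prod_congr rfl fun k hk => ?_
    rw [Matrix.updateCol_ne (Finset.ne_of_mem_erase hk)]

lemma IsVariation.det [DecidableEq ι] {n : Type*} [Fintype n] [DecidableEq n]
    {G G' : Matrix n n (MvPowerSeries ι ℝ)} {Gj : ι → Matrix n n (MvPowerSeries ι ℝ)}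
    (h : ∀ a b, IsVariation (G a b) (fun j => Gj j a b) (G' a b)) :
    IsVariation G.det (fun j => (Gj j).det) (G.adjugate * G').trace := by
  have := IsVariation.sum Finset.univ fun σ : Equiv.Perm n =>
    (IsVariation.prod Finset.univ fun k => h (σ k) k).smul ((Equiv.Perm.sign σ : ℤ) : ℝ)
  rw [trace_adjugate_mul]
  simp only [Matrix.det_apply, Units.smul_def, ← Int.cast_smul_eq_zsmul ℝ]
  exact this

end SquarefreeCoefficients

/-! ### Resolvent identities for a compressed matrix. -/

section MatrixIdentities

variable {R : Type*} [CommRing R]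

/-- The inclusion of the first `m` coordinates. -/
def emb (R : Type*) [CommRing R] (m : ℕ) : Matrix (Fin (m + 1)) (Fin m) R :=
  Matrix.of fun a b => if a = b.castSucc then 1 else 0

open Matrix

lemma emb_transpose_mul_emb (m : ℕ) : (emb R m)ᵀ * emb R m = 1 := by
  ext a b
  simp [emb, Matrix.mul_apply, Matrix.one_apply, eq_comm]

lemma emb_conj (m : ℕ) (N : Matrix (Fin (m + 1)) (Fin (m + 1)) R) :
    (emb R m)ᵀ * N * emb R m = N.submatrix Fin.castSucc Fin.castSucc := by
  ext a b
  simp [emb, Matrix.mul_apply]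

/-- Both claims follow from the push-through identities `Eᵀ X = H Eᵀ N` and `X E = N E H` and the
cyclicity of the trace. They replace the inverse `H` by a linear recursion for `X` and move the
commutator with `B` from `N` to the projection `E Eᵀ`. -/
theorem resolvent_identities (m : ℕ) (N B : Matrix (Fin (m + 1)) (Fin (m + 1)) R)
    {H : Matrix (Fin m) (Fin m) R} (hH : (1 + (emb R m)ᵀ * N * emb R m) * H = 1)
    {X : Matrix (Fin (m + 1)) (Fin (m + 1)) R}
    (hX : X = N - N * emb R m * H * (emb R m)ᵀ * N) :
    X = N - N * (emb R m * (emb R m)ᵀ) * X ∧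
      (H * ((emb R m)ᵀ * (N * B - B * N) * emb R m)).trace =
        ((B * (emb R m * (emb R m)ᵀ) - emb R m * (emb R m)ᵀ * B) * X).trace := by
  set E := emb R m
  have hE : Eᵀ * E = 1 := emb_transpose_mul_emb m
  have hH' : H * (1 + Eᵀ * N * E) = 1 := mul_eq_one_comm.1 hH
  have h1 : Eᵀ * N * E * H = 1 - H := by
    rw [← hH]; noncomm_ring
  have h2 : H * (Eᵀ * N * E) = 1 - H := by
    rw [← hH']; noncomm_ring
  have hl : Eᵀ * X = H * Eᵀ * N := by
    calc Eᵀ * X = Eᵀ * N - (Eᵀ * N * E * H) * Eᵀ * N := by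
          rw [hX, Matrix.mul_sub]; simp only [Matrix.mul_assoc]
      _ = _ := by rw [h1]; simp only [Matrix.sub_mul, Matrix.one_mul]; abel
  have hr : X * E = N * E * H := by
    calc X * E = N * E - N * E * (H * (Eᵀ * N * E)) := by
          rw [hX, Matrix.sub_mul]; simp only [Matrix.mul_assoc]
      _ = _ := by rw [h2]; simp only [Matrix.mul_sub, Matrix.mul_one]; abel
  constructor
  · conv_lhs => rw [hX]
    congr 1
    calc N * E * H * Eᵀ * N = N * E * (H * Eᵀ * N) := by simp only [Matrix.mul_assoc]
      _ = _ := by rw [← hl]; simp only [Matrix.mul_assoc]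
  · have e1 : (H * (Eᵀ * (N * B) * E)).trace = (B * (E * Eᵀ) * X).trace := by
      calc (H * (Eᵀ * (N * B) * E)).trace = ((H * Eᵀ * N) * (B * E)).trace := by
            simp only [Matrix.mul_assoc]
        _ = _ := by rw [← hl, Matrix.trace_mul_comm]; simp only [Matrix.mul_assoc]
    have e2 : (H * (Eᵀ * (B * N) * E)).trace = (E * Eᵀ * B * X).trace := by
      calc (H * (Eᵀ * (B * N) * E)).trace = ((Eᵀ * B) * (N * E * H)).trace := by
            rw [Matrix.trace_mul_comm]; simp only [Matrix.mul_assoc]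
        _ = (Eᵀ * (B * X * E)).trace := by rw [← hr]; simp only [Matrix.mul_assoc]
        _ = _ := by rw [← Matrix.mul_assoc, Matrix.trace_mul_comm]; simp only [Matrix.mul_assoc]
    simp only [Matrix.mul_sub, Matrix.sub_mul, Matrix.trace_sub]
    rw [e1, e2]

end MatrixIdentities

/-! ### The generating determinant and the two expansions of its logarithmic derivative. -/

section GeneratingMatrix

open Matrix

variable {ι : Type*}

/-- The entrywise squarefree coefficient of a matrix of power series. -/
def sqfreeCoeffMatrix {n p : Type*} (S : Finset ι) (X : Matrix n p (MvPowerSeries ι ℝ)) :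
    Matrix n p ℝ := X.map (sqfreeCoeff S)

/-- A real matrix as a matrix of constant power series. -/
def constMatrix (ι : Type*) {n p : Type*} (X : Matrix n p ℝ) : Matrix n p (MvPowerSeries ι ℝ) :=
  X.map (MvPowerSeries.C : ℝ →+* MvPowerSeries ι ℝ)

lemma constMatrix_mul {n p q : Type*} [Fintype p] (X : Matrix n p ℝ) (Y : Matrix p q ℝ) :
    constMatrix ι (X * Y) = constMatrix ι X * constMatrix ι Y :=
  Matrix.map_mul

lemma constMatrix_sub {n p : Type*} (X Y : Matrix n p ℝ) :
    constMatrix ι (X - Y) = constMatrix ι X - constMatrix ι Y :=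
  Matrix.map_sub _ (map_sub _) _ _

lemma sqfreeCoeffMatrix_mul [DecidableEq ι] {n p q : Type*} [Fintype p] (S : Finset ι)
    (X : Matrix n p (MvPowerSeries ι ℝ)) (Y : Matrix p q (MvPowerSeries ι ℝ)) :
    sqfreeCoeffMatrix S (X * Y) =
      ∑ T ∈ S.powerset, sqfreeCoeffMatrix T X * sqfreeCoeffMatrix (S \ T) Y := by
  ext a b
  simp only [sqfreeCoeffMatrix, map_apply, mul_apply, map_sum, sqfreeCoeff_mul, Matrix.sum_apply]
  rw [Finset.sum_comm]

lemma sqfreeCoeff_C_mul (S : Finset ι) (c : ℝ) (p : MvPowerSeries ι ℝ) :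
    sqfreeCoeff S (MvPowerSeries.C c * p) = c * sqfreeCoeff S p :=
  MvPowerSeries.coeff_C_mul _ _ _

lemma sqfreeCoeffMatrix_C_mul [DecidableEq ι] {n p q : Type*} [Fintype p] (S : Finset ι)
    (X : Matrix n p ℝ) (Y : Matrix p q (MvPowerSeries ι ℝ)) :
    sqfreeCoeffMatrix S (constMatrix ι X * Y) = X * sqfreeCoeffMatrix S Y := by
  ext a b
  simp only [sqfreeCoeffMatrix, constMatrix, map_apply, mul_apply, map_sum, sqfreeCoeff_C_mul]

lemma sqfreeCoeffMatrix_mul_C [DecidableEq ι] {n p q : Type*} [Fintype p] (S : Finset ι)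
    (X : Matrix n p (MvPowerSeries ι ℝ)) (Y : Matrix p q ℝ) :
    sqfreeCoeffMatrix S (X * constMatrix ι Y) = sqfreeCoeffMatrix S X * Y := by
  ext a b
  simp only [sqfreeCoeffMatrix, constMatrix, map_apply, mul_apply, map_sum]
  refine Finset.sum_congr rfl fun c _ => ?_
  rw [mul_comm, sqfreeCoeff_C_mul, mul_comm]

lemma sqfreeCoeffMatrix_sub {n p : Type*} (S : Finset ι)
    (X Y : Matrix n p (MvPowerSeries ι ℝ)) :
    sqfreeCoeffMatrix S (X - Y) = sqfreeCoeffMatrix S X - sqfreeCoeffMatrix S Y := by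
  ext a b
  simp [sqfreeCoeffMatrix]

lemma emb_map_C (m : ℕ) :
    constMatrix ι (emb ℝ m) = emb (MvPowerSeries ι ℝ) m := by
  ext a b
  simp only [emb, constMatrix, map_apply, of_apply]
  split_ifs <;> simp

/-- The projection onto the first `m` coordinates. -/
def proj (m : ℕ) : Matrix (Fin (m + 1)) (Fin (m + 1)) ℝ := emb ℝ m * (emb ℝ m)ᵀ

lemma proj_map_C (m : ℕ) :
    constMatrix ι (proj m) = emb (MvPowerSeries ι ℝ) m * (emb (MvPowerSeries ι ℝ) m)ᵀ := by
  rw [proj, constMatrix_mul, ← emb_map_C]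
  rfl

/-- The generating series of a family of matrices indexed by finite sets. -/
def genMatrix [DecidableEq ι] {n : Type*} (N : Finset ι → Matrix n n ℝ) :
    Matrix n n (MvPowerSeries ι ℝ) :=
  Matrix.of fun a b => sqfreeSeries fun S => N S a b

lemma sqfreeCoeffMatrix_genMatrix [DecidableEq ι] {n : Type*} (N : Finset ι → Matrix n n ℝ) (S :
    Finset ι) :
    sqfreeCoeffMatrix S (genMatrix N) = N S := by
  ext a b
  simp [sqfreeCoeffMatrix, genMatrix]

/-- The generating matrix whose determinant generates the joint moments. -/
def momentMatrix [DecidableEq ι] {m : ℕ} (N : Finset ι → Matrix (Fin (m + 1)) (Fin (m + 1)) ℝ) :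
    Matrix (Fin m) (Fin m) (MvPowerSeries ι ℝ) :=
  1 + (emb (MvPowerSeries ι ℝ) m)ᵀ * genMatrix N * emb (MvPowerSeries ι ℝ) m

/-- The compressed commutator which varies `momentMatrix`. -/
def momentMatrixDeriv [DecidableEq ι] {m : ℕ} (B : Matrix (Fin (m + 1)) (Fin (m + 1)) ℝ)
    (N : Finset ι → Matrix (Fin (m + 1)) (Fin (m + 1)) ℝ) :
    Matrix (Fin m) (Fin m) (MvPowerSeries ι ℝ) :=
  (1 / 2 : ℝ) • ((emb (MvPowerSeries ι ℝ) m)ᵀ * (genMatrix N * constMatrix ι B -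
    constMatrix ι B * genMatrix N) * emb (MvPowerSeries ι ℝ) m)

lemma sqfreeCoeff_momentMatrix [DecidableEq ι] {m : ℕ} (N :
    Finset ι → Matrix (Fin (m + 1)) (Fin (m + 1)) ℝ)
    (S : Finset ι) (a b : Fin m) :
    sqfreeCoeff S (momentMatrix N a b) =
      (if S = ∅ then (1 : Matrix (Fin m) (Fin m) ℝ) a b else 0) + N S a.castSucc b.castSucc := by
  rw [momentMatrix, Matrix.add_apply, map_add, emb_conj, submatrix_apply]
  congr 1
  · rw [Matrix.one_apply, Matrix.one_apply]
    split_ifs with h1 h2 h2 <;> simp [sqfreeCoeff_one, h2]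
  · simp [genMatrix]

lemma sqfreeCoeff_momentMatrixDeriv [DecidableEq ι] {m : ℕ} (B :
    Matrix (Fin (m + 1)) (Fin (m + 1)) ℝ)
    (N : Finset ι → Matrix (Fin (m + 1)) (Fin (m + 1)) ℝ) (S : Finset ι) (a b : Fin m) :
    sqfreeCoeff S (momentMatrixDeriv B N a b) =
      (1 / 2 : ℝ) * (N S * B - B * N S) a.castSucc b.castSucc := by
  rw [momentMatrixDeriv, Matrix.smul_apply, map_smul, emb_conj, submatrix_apply, smul_eq_mul]
  congr 1
  have := congrFun (congrFun (sqfreeCoeffMatrix_sub S (genMatrix N * constMatrix ι B)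
    (constMatrix ι B * genMatrix N)) a.castSucc) b.castSucc
  rw [sqfreeCoeffMatrix_C_mul, sqfreeCoeffMatrix_mul_C, sqfreeCoeffMatrix_genMatrix] at this
  exact this

lemma constantCoeff_det_momentMatrix [DecidableEq ι] {m : ℕ}
    {N : Finset ι → Matrix (Fin (m + 1)) (Fin (m + 1)) ℝ} (hN : N ∅ = 0) :
    MvPowerSeries.constantCoeff (momentMatrix N).det = 1 := by
  rw [RingHom.map_det]
  convert Matrix.det_one (n := Fin m) (R := ℝ)
  ext a b
  rw [RingHom.mapMatrix_apply, map_apply, ← sqfreeCoeff_empty, sqfreeCoeff_momentMatrix, hN]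
  simp

/-- The logarithmic derivative of the determinant, expanded in two ways. -/
theorem sum_moments_eq_sum_trace [DecidableEq ι] [Fintype ι] [Nonempty ι] {m : ℕ}
    {N : Finset ι → Matrix (Fin (m + 1)) (Fin (m + 1)) ℝ} (hN : N ∅ = 0)
    (B : Matrix (Fin (m + 1)) (Fin (m + 1)) ℝ) {M M' : Finset ι → ℝ}
    (hM : ∀ S, sqfreeCoeff S (momentMatrix N).det = M S)
    (hM' : ∀ S, sqfreeCoeff S ((momentMatrix N).adjugate * momentMatrixDeriv B N).trace = M' S) :
    ∑ π : Finpartition (Finset.univ : Finset ι), (-1) ^ (π.parts.card - 1) *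
      (((π.parts.card - 1).factorial : ℝ) *
        ∑ S ∈ π.parts, M' S * ∏ T ∈ π.parts.erase S, M T) =
    ∑ π : Finpartition (Finset.univ : Finset ι), (-1) ^ (π.parts.card - 1) *
      ∑ e : Fin (π.parts.card - 1 + 1) ≃ π.parts,
        (((1 / 2 : ℝ) • (B * proj m - proj m * B)) *
          chainProd (fun S => N S * proj m) N (π.parts.card - 1) fun i => (e i).1).trace := by
  set G := momentMatrix N with hG
  set G' := momentMatrixDeriv B N with hG'
  have hc : MvPowerSeries.constantCoeff G.det ≠ 0 := by
    rw [constantCoeff_det_momentMatrix hN]; exact one_ne_zero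
  have hdet : IsUnit G.det := by
    rw [MvPowerSeries.isUnit_iff_constantCoeff]
    exact hc.isUnit
  have hGH : G * G⁻¹ = 1 := Matrix.mul_nonsing_inv _ hdet
  set q := (G⁻¹ * G').trace with hq
  have hFq : G.det * q = (G.adjugate * G').trace := by
    have : G.adjugate = G.det • G⁻¹ := by
      calc G.adjugate = G.adjugate * (G * G⁻¹) := by rw [hGH, Matrix.mul_one]
        _ = G.det • G⁻¹ := by
          rw [← Matrix.mul_assoc, Matrix.adjugate_mul, Matrix.smul_mul, Matrix.one_mul]
    rw [this, Matrix.smul_mul, Matrix.trace_smul, smul_eq_mul]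
  set n := genMatrix N with hn
  obtain ⟨X, hXdef⟩ : ∃ X, X = n - n * emb (MvPowerSeries ι ℝ) m * G⁻¹ *
    (emb (MvPowerSeries ι ℝ) m)ᵀ * n := ⟨_, rfl⟩
  obtain ⟨hX, htr⟩ := resolvent_identities m n (constMatrix ι B) (H := G⁻¹) hGH hXdef
  have hM0 : M ∅ = 1 := by
    rw [← hM, sqfreeCoeff_empty, constantCoeff_det_momentMatrix hN]
  -- the scalar expansion
  have hs : sqfreeCoeff Finset.univ q =
      ∑ π : Finpartition (Finset.univ : Finset ι), (-1) ^ (π.parts.card - 1) *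
      (((π.parts.card - 1).factorial : ℝ) *
        ∑ S ∈ π.parts, M' S * ∏ T ∈ π.parts.erase S, M T) := by
    have hG'0 : M' ∅ = 0 := by
      rw [← hM', sqfreeCoeff_empty, Matrix.trace, map_sum]
      refine Finset.sum_eq_zero fun i _ => ?_
      rw [Matrix.diag_apply, Matrix.mul_apply, map_sum]
      refine Finset.sum_eq_zero fun j _ => ?_
      rw [map_mul, ← sqfreeCoeff_empty (G' j i), hG', sqfreeCoeff_momentMatrixDeriv, hN]
      simp
    have key := eq_sum_finpartition (A := ℝ) (n := fun S => if S = ∅ then 0 else M S) (r := M')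
      (q := fun S => sqfreeCoeff S q) (by simp) hG'0 (fun S => by
        -- Since `G.det` has constant term `1`, the series `G.det - 1` can serve as the coefficient
        -- of a recursion with `n ∅ = 0`.
        have h1 : q = (G.adjugate * G').trace - (G.det - 1) * q := by rw [← hFq]; ring
        conv_lhs => rw [h1]
        rw [map_sub, hM', sqfreeCoeff_mul]
        congr 1
        refine Finset.sum_congr rfl fun T _ => ?_
        rw [map_sub, hM, sqfreeCoeff_one]
        split_ifs with h
        · rw [h, hM0]; simp
        · simp)
    refine key.trans (Finset.sum_congr rfl fun π _ => ?_)
    have hpos := parts_card_pos π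
    rw [sum_chainProd_equiv _ _ _ _ (by omega)]
    congr 2
    refine Finset.sum_congr rfl fun S _ => ?_
    congr 1
    refine Finset.prod_congr rfl fun T hT => ?_
    rw [if_neg (π.nonempty_of_mem_parts (Finset.mem_of_mem_erase hT)).ne_empty]
  -- the matrix expansion
  have hm : sqfreeCoeff Finset.univ q =
      (((1 / 2 : ℝ) • (B * proj m - proj m * B)) * sqfreeCoeffMatrix Finset.univ X).trace := by
    have h1 : q = (1 / 2 : ℝ) •
        (constMatrix ι (B * proj m - proj m * B) * X).trace := by
      rw [hq, hG', momentMatrixDeriv, Matrix.mul_smul, Matrix.trace_smul, htr]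
      congr 3
      rw [constMatrix_sub, constMatrix_mul, constMatrix_mul, proj_map_C]
    have h2 : ∀ Z : Matrix (Fin (m + 1)) (Fin (m + 1)) (MvPowerSeries ι ℝ),
        sqfreeCoeff Finset.univ Z.trace = (sqfreeCoeffMatrix Finset.univ Z).trace := by
      intro Z
      simp [Matrix.trace, sqfreeCoeffMatrix]
    rw [h1, map_smul, h2, sqfreeCoeffMatrix_C_mul, Matrix.smul_mul, Matrix.trace_smul]
  rw [← hs, hm]
  have key := eq_sum_finpartition (n := fun S => N S * proj m) (r := N)
    -- The fixed-point equation `X = N - N P X`, read coefficientwise; its iteration is the Neumann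
    -- series.
    (q := fun S => sqfreeCoeffMatrix S X) (by simp [hN]) hN (fun S => by
      conv_lhs => rw [hX]
      rw [sqfreeCoeffMatrix_sub, hn, sqfreeCoeffMatrix_genMatrix, ← proj_map_C,
        sqfreeCoeffMatrix_mul]
      congr 1
      refine Finset.sum_congr rfl fun T _ => ?_
      rw [sqfreeCoeffMatrix_mul_C, sqfreeCoeffMatrix_genMatrix])
  rw [key, Matrix.mul_sum, Matrix.trace_sum]
  refine Finset.sum_congr rfl fun π _ => ?_
  have : ∀ (k : ℕ) (Z W : Matrix (Fin (m + 1)) (Fin (m + 1)) ℝ),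
      (Z * ((-1) ^ k * W)).trace = (-1) ^ k * (Z * W).trace := by
    intro k Z W
    rcases neg_one_pow_eq_or (Matrix (Fin (m + 1)) (Fin (m + 1)) ℝ) k with h | h <;>
    rcases Nat.even_or_odd k with h' | h' <;>
    simp [h'.neg_one_pow]
  rw [this, Matrix.mul_sum, Matrix.trace_sum]

end GeneratingMatrix

/-! ### Laguerre polynomials and the action of `2x d/dx + α + 1 - x`. -/

section Laguerre

open Polynomial

/-- The coefficients of the generalized Laguerre polynomials. -/
def laguerreCoeff (α : ℝ) (n k : ℕ) : ℝ :=
  if k ≤ n then (-1) ^ k * (Real.Gamma (n + α + 1) /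
    (Real.Gamma (k + α + 1) * (n - k).factorial)) / k.factorial else 0

/-- The generalized Laguerre polynomials as polynomials. -/
def laguerrePoly (α : ℝ) (n : ℕ) : ℝ[X] :=
  ∑ k ∈ Finset.range (n + 1), monomial k (laguerreCoeff α n k)

lemma laguerre_eq_sum (α : ℝ) (n : ℕ) (x : ℝ) :
    laguerre α n x = ∑ k ∈ Finset.range (n + 1), laguerreCoeff α n k * x ^ k := by
  rw [laguerre]
  refine Finset.sum_congr rfl fun k hk => ?_
  rw [laguerreCoeff, if_pos (Finset.mem_range_succ_iff.1 hk)]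
  ring

lemma eval_laguerrePoly (α : ℝ) (n : ℕ) (x : ℝ) :
    (laguerrePoly α n).eval x = laguerre α n x := by
  rw [laguerre_eq_sum, laguerrePoly, eval_finsetSum]
  simp only [eval_monomial]

lemma coeff_laguerrePoly (α : ℝ) (n k : ℕ) :
    (laguerrePoly α n).coeff k = laguerreCoeff α n k := by
  rw [laguerrePoly, finsetSum_coeff]
  simp only [coeff_monomial]
  rw [Finset.sum_ite_eq']
  split_ifs with h
  · rfl
  · rw [laguerreCoeff, if_neg]
    simpa [Nat.lt_succ_iff] using h

lemma gamma_pos {α : ℝ} (hα : 0 ≤ α) (n : ℕ) : 0 < Real.Gamma (n + α + 1) :=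
  Real.Gamma_pos_of_pos (by positivity)

lemma gamma_succ {α : ℝ} (hα : 0 ≤ α) (n : ℕ) :
    Real.Gamma ((n + 1 : ℕ) + α + 1) = (n + α + 1) * Real.Gamma (n + α + 1) := by
  rw [← Real.Gamma_add_one (by positivity)]
  congr 1
  push_cast
  ring

lemma gamma_add_nat {x : ℝ} (hx : 0 < x) (j : ℕ) :
    Real.Gamma (x + j) = (ascPochhammer ℝ j).eval x * Real.Gamma x := by
  induction j with
  | zero => simp
  | succ j ih =>
    rw [Nat.cast_succ, ← add_assoc, Real.Gamma_add_one (by positivity), ih,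
      ascPochhammer_succ_eval]
    ring

/-- The combination `2 x L_n' + (α + 1 - x) L_n`, expanded in Laguerre polynomials. -/
def laguerreShift (α : ℝ) (n : ℕ) (x : ℝ) : ℝ :=
  (n + 1) * laguerre α (n + 1) x - if n = 0 then 0 else (n + α) * laguerre α (n - 1) x

/-- The coefficient of `x^k` in the identity `2x L_n' + (α+1-x) L_n = (n+1) L_{n+1} - (n+α)
L_{n-1}`. For `n = 0` the last term must be suppressed by hand: the truncated index `n - 1` would
give a spurious `α L_0`. -/
lemma laguerreCoeff_recurrence {α : ℝ} (hα : 0 ≤ α) (n k : ℕ) :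
    (2 * k + α + 1) * laguerreCoeff α n k - (if k = 0 then 0 else laguerreCoeff α n (k - 1)) =
      (n + 1) * laguerreCoeff α (n + 1) k -
        if n = 0 then 0 else (n + α) * laguerreCoeff α (n - 1) k := by
  have hG := fun n => (gamma_pos hα n).ne'
  have hF : ∀ n : ℕ, (n.factorial : ℝ) ≠ 0 := fun n => by positivity
  have e1 : (if k = 0 then 0 else laguerreCoeff α n (k - 1)) =
      if k ≤ n + 1 then -(-1) ^ k * (k * (k + α)) * Real.Gamma (n + α + 1) /
        (Real.Gamma (k + α + 1) * (n + 1 - k).factorial * k.factorial) else 0 := by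
    rcases k with _ | k
    · simp
    · simp only [Nat.add_sub_cancel, laguerreCoeff, Nat.add_le_add_iff_right, Nat.succ_ne_zero,
        if_false, Nat.add_sub_add_right]
      split_ifs with h
      · rw [gamma_succ hα k, Nat.factorial_succ]
        have := hG k; have := hF k; have := hF (n - k)
        have h1 : (k : ℝ) + α + 1 ≠ 0 := by positivity
        have h2 : (k : ℝ) + 1 ≠ 0 := by positivity
        push_cast
        field_simp
        ring
      · rfl
  have e2 : (if n = 0 then 0 else (n + α) * laguerreCoeff α (n - 1) k) =
      if k ≤ n then (-1) ^ k * (n - k) * Real.Gamma (n + α + 1) /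
        (Real.Gamma (k + α + 1) * (n - k).factorial * k.factorial) else 0 := by
    rcases n with _ | n
    · rcases k with _ | k <;> simp
    · simp only [Nat.add_sub_cancel, laguerreCoeff, Nat.succ_ne_zero, if_false]
      have := hG k; have := hF k
      by_cases h : k ≤ n
      · rw [if_pos h, if_pos (by omega), gamma_succ hα n, Nat.succ_sub h, Nat.factorial_succ]
        have := hF (n - k)
        have h1 : ((n - k : ℕ) : ℝ) = n - k := Nat.cast_sub h
        have h2 : (n : ℝ) - k + 1 ≠ 0 := by
          rw [← h1]; positivity
        push_cast
        rw [h1]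
        field_simp
        ring
      · rw [if_neg h]
        split_ifs with h'
        · have : k = n + 1 := by omega
          subst this
          push_cast
          ring
        · ring
  rw [e1, e2]
  simp only [laguerreCoeff]
  have := hG k; have := hF k
  rcases Nat.lt_trichotomy k (n + 1) with h | h | h
  · have hk : k ≤ n := by omega
    rw [if_pos hk, if_pos h.le, if_pos h.le, if_pos hk, gamma_succ hα n, Nat.succ_sub hk,
      Nat.factorial_succ]
    have := hF (n - k)
    have h1 : ((n - k : ℕ) : ℝ) = n - k := Nat.cast_sub hk
    have h2 : (n : ℝ) - k + 1 ≠ 0 := by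
      rw [← h1]; positivity
    push_cast
    rw [h1]
    field_simp
    ring
  · subst h
    rw [if_neg (by omega), if_pos le_rfl, if_pos le_rfl, if_neg (by omega)]
    rw [gamma_succ hα n]
    have := hG n
    simp only [Nat.sub_self, Nat.factorial_zero]
    push_cast
    have h1 : (n : ℝ) + α + 1 ≠ 0 := by positivity
    field_simp
    ring
  · rw [if_neg (by omega), if_neg (by omega), if_neg (by omega), if_neg (by omega)]
    ring

lemma laguerreShift_eq {α : ℝ} (hα : 0 ≤ α) (n : ℕ) (x : ℝ) :
    2 * x * (derivative (laguerrePoly α n)).eval x + (α + 1 - x) * laguerre α n x =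
      laguerreShift α n x := by
  have h : C 2 * (X * derivative (laguerrePoly α n)) + C (α + 1) * laguerrePoly α n -
      X * laguerrePoly α n = C (n + 1 : ℝ) * laguerrePoly α (n + 1) -
        if n = 0 then 0 else C (n + α) * laguerrePoly α (n - 1) := by
    ext k
    have := laguerreCoeff_recurrence hα n k
    rw [coeff_sub, coeff_sub, coeff_add, coeff_C_mul, coeff_C_mul, coeff_C_mul,
      coeff_laguerrePoly, coeff_laguerrePoly]
    have e1 : (if n = 0 then 0 else C (n + α) * laguerrePoly α (n - 1)).coeff k =
        if n = 0 then 0 else (n + α) * laguerreCoeff α (n - 1) k := by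
      split_ifs
      · simp
      · rw [coeff_C_mul, coeff_laguerrePoly]
    rw [e1, ← this]
    rcases k with _ | k
    · simp
    · rw [coeff_X_mul, coeff_X_mul, coeff_derivative, coeff_laguerrePoly, coeff_laguerrePoly]
      simp
      ring
  have := congrArg (eval x) h
  rw [laguerreShift]
  have e1 : eval x (if n = 0 then 0 else C (n + α) * laguerrePoly α (n - 1)) =
      if n = 0 then 0 else (n + α) * laguerre α (n - 1) x := by
    split_ifs
    · simp
    · rw [eval_mul, eval_C, eval_laguerrePoly]
  simp only [eval_sub, eval_add, eval_mul, eval_C, eval_X, eval_laguerrePoly, e1] at this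
  rw [← this]
  ring

end Laguerre

/-! ### Orthogonality by finite differences. -/

section Orthogonality

lemma weight_nonneg {α x : ℝ} (hx : 0 ≤ x) : 0 ≤ weight α x :=
  mul_nonneg (Real.rpow_nonneg hx _) (Real.exp_pos _).le

lemma pow_mul_weight {α x : ℝ} (hx : 0 < x) (j : ℕ) :
    x ^ j * weight α x = Real.exp (-x) * x ^ ((j : ℝ) + α + 1 - 1) := by
  rw [weight, add_sub_cancel_right, Real.rpow_add hx, Real.rpow_natCast]
  ring

lemma integrableOn_pow_mul_weight {α : ℝ} (hα : 0 ≤ α) (j : ℕ) :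
    IntegrableOn (fun x => x ^ j * weight α x) (Ioi 0) :=
  (Real.GammaIntegral_convergent (by positivity)).congr_fun
    (fun x hx => (pow_mul_weight hx j).symm) measurableSet_Ioi

lemma integral_pow_mul_weight {α : ℝ} (hα : 0 ≤ α) (j : ℕ) :
    ∫ x in Ioi 0, x ^ j * weight α x = Real.Gamma (j + α + 1) := by
  rw [Real.Gamma_eq_integral (by positivity)]
  exact setIntegral_congr_fun measurableSet_Ioi fun x hx => pow_mul_weight hx j

/-- Up to sign the sum is the `n`-th forward difference at `0`, which kills degrees below `n` and
sends `x^n` to `n!`. -/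
lemma alternating_sum_choose_mul_eval (P : Polynomial ℝ) (n : ℕ) (hP : P.natDegree ≤ n) :
    ∑ k ∈ Finset.range (n + 1), (-1) ^ k * (n.choose k : ℝ) * P.eval (k : ℝ) =
      (-1) ^ n * if P.natDegree = n then P.leadingCoeff * n.factorial else 0 := by
  have h := fwdDiff_iter_eq_sum_shift (1 : ℝ) P.eval n 0
  have hl : (fwdDiff (1 : ℝ))^[n] P.eval 0 =
      if P.natDegree = n then P.leadingCoeff * n.factorial else 0 := by
    split_ifs with hn
    · have := congrFun P.fwdDiff_iter_degree_eq_factorial 0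
      rw [hn] at this
      rw [this]
      simp
    · rw [Polynomial.fwdDiff_iter_eq_zero_of_degree_lt (lt_of_le_of_ne hP hn)]
      rfl
  rw [← hl, h, Finset.mul_sum]
  refine Finset.sum_congr rfl fun k hk => ?_
  have hk' : k ≤ n := Finset.mem_range_succ_iff.1 hk
  have : ((-1 : ℝ)) ^ k = (-1) ^ n * (-1) ^ (n - k) := by
    rw [← pow_add, show n + (n - k) = k + 2 * (n - k) by omega, pow_add, pow_mul]
    simp
  rw [this, zsmul_eq_mul]
  push_cast
  simp
  ring

/-- Integrating termwise produces the ratios `Γ(k+j+α+1) / Γ(k+α+1)`, a monic polynomial in `k` of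
degree `j`, so the integral is a multiple of its `n`-th finite difference. -/
lemma integral_pow_mul_laguerre {α : ℝ} (hα : 0 ≤ α) {j n : ℕ} (hj : j ≤ n) :
    ∫ x in Ioi 0, x ^ j * laguerre α n x * weight α x =
      if j = n then (-1) ^ n * Real.Gamma (n + α + 1) else 0 := by
  have hF : ∀ n : ℕ, (n.factorial : ℝ) ≠ 0 := fun n => by positivity
  set P : Polynomial ℝ := (ascPochhammer ℝ j).comp (Polynomial.X + Polynomial.C (α + 1)) with hP
  have hdeg : P.natDegree = j := by
    rw [hP, Polynomial.natDegree_comp, ascPochhammer_natDegree, Polynomial.natDegree_X_add_C,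
      mul_one]
  have hmon : P.leadingCoeff = 1 := (monic_ascPochhammer ℝ j).comp_X_add_C _
  have h1 : ∀ x, x ^ j * laguerre α n x * weight α x =
      ∑ k ∈ Finset.range (n + 1), laguerreCoeff α n k * (x ^ (k + j) * weight α x) := by
    intro x
    rw [laguerre_eq_sum, Finset.mul_sum, Finset.sum_mul]
    refine Finset.sum_congr rfl fun k _ => ?_
    rw [pow_add]
    ring
  simp only [h1]
  rw [integral_finsetSum _ fun k _ => (integrableOn_pow_mul_weight hα (k + j)).const_mul _]
  simp only [integral_const_mul, integral_pow_mul_weight hα]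
  have h2 : ∀ k ∈ Finset.range (n + 1), laguerreCoeff α n k *
      Real.Gamma ((k + j : ℕ) + α + 1) = Real.Gamma (n + α + 1) / n.factorial *
        ((-1) ^ k * (n.choose k : ℝ) * P.eval (k : ℝ)) := by
    intro k hk
    have hk' : k ≤ n := Finset.mem_range_succ_iff.1 hk
    have e : ((k + j : ℕ) : ℝ) + α + 1 = (k + α + 1) + j := by push_cast; ring
    have e2 : P.eval (k : ℝ) = (ascPochhammer ℝ j).eval (k + α + 1) := by
      rw [hP, Polynomial.eval_comp]
      simp [add_assoc]
    rw [e, gamma_add_nat (by positivity), e2, laguerreCoeff, if_pos hk',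
      Nat.cast_choose ℝ hk']
    have := (gamma_pos hα k).ne'
    have := hF n; have := hF k; have := hF (n - k)
    field_simp
  rw [Finset.sum_congr rfl h2, ← Finset.mul_sum,
    alternating_sum_choose_mul_eval P n (hdeg.le.trans hj), hdeg, hmon]
  split_ifs
  · have := hF n
    field_simp
  · simp

lemma integrableOn_laguerre_mul {α : ℝ} (hα : 0 ≤ α) (j n : ℕ) :
    IntegrableOn (fun x => x ^ j * laguerre α n x * weight α x) (Ioi 0) := by
  have h1 : (fun x => x ^ j * laguerre α n x * weight α x) = fun x =>
      ∑ k ∈ Finset.range (n + 1), laguerreCoeff α n k * (x ^ (k + j) * weight α x) := by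
    funext x
    rw [laguerre_eq_sum, Finset.mul_sum, Finset.sum_mul]
    refine Finset.sum_congr rfl fun k _ => ?_
    rw [pow_add]
    ring
  rw [h1]
  exact integrable_finsetSum _ fun k _ => (integrableOn_pow_mul_weight hα (k + j)).const_mul _

lemma integral_laguerre_mul_of_le {α : ℝ} (hα : 0 ≤ α) {a b : ℕ} (hab : a ≤ b) :
    ∫ x in Ioi 0, laguerre α a x * laguerre α b x * weight α x =
      if a = b then Real.Gamma (a + α + 1) / a.factorial else 0 := by
  have h1 : ∀ x, laguerre α a x * laguerre α b x * weight α x =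
      ∑ k ∈ Finset.range (a + 1), laguerreCoeff α a k * (x ^ k * laguerre α b x * weight α x) := by
    intro x
    rw [laguerre_eq_sum α a, Finset.sum_mul, Finset.sum_mul]
    refine Finset.sum_congr rfl fun k _ => ?_
    ring
  simp only [h1]
  rw [integral_finsetSum _ fun k _ => (integrableOn_laguerre_mul hα k b).const_mul _]
  simp only [integral_const_mul]
  rw [Finset.sum_congr rfl fun k hk => by
    rw [integral_pow_mul_laguerre hα ((Finset.mem_range_succ_iff.1 hk).trans hab)]]
  split_ifs with h
  · subst h
    rw [Finset.sum_eq_single a]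
    · rw [if_pos rfl, laguerreCoeff, if_pos le_rfl]
      have := (gamma_pos hα a).ne'
      have h2 : ((-1 : ℝ) ^ a) * (-1) ^ a = 1 := by
        rw [← mul_pow]; simp
      simp only [Nat.sub_self, Nat.factorial_zero, Nat.cast_one, mul_one]
      rw [div_self this]
      linear_combination (Real.Gamma (a + α + 1) / a.factorial) * h2
    · intro k _ hk
      rw [if_neg hk, mul_zero]
    · simp
  · refine Finset.sum_eq_zero fun k hk => ?_
    have := Finset.mem_range_succ_iff.1 hk
    rw [if_neg (by omega), mul_zero]

/-- The orthogonality relations of the Laguerre polynomials. -/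
theorem integral_laguerre_mul {α : ℝ} (hα : 0 ≤ α) (a b : ℕ) :
    ∫ x in Ioi 0, laguerre α a x * laguerre α b x * weight α x =
      if a = b then Real.Gamma (a + α + 1) / a.factorial else 0 := by
  rcases le_total a b with h | h
  · exact integral_laguerre_mul_of_le hα h
  · simp only [mul_comm (laguerre α a _)]
    rw [integral_laguerre_mul_of_le hα h]
    by_cases hab : a = b
    · subst hab; rfl
    · rw [if_neg hab, if_neg (Ne.symm hab)]

end Orthogonality

/-! ### Integration by parts on the half line and a Hardy type inequality. -/

section IntegrationByParts

open Filter Topology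

/-- A derivative integrates to zero on `(0, ∞)` if it is integrable together with `F x / x`. -/
theorem integral_Ioi_deriv_eq_zero {F F' : ℝ → ℝ} (hF : ∀ x, 0 < x → HasDerivAt F (F' x) x)
    (hF' : IntegrableOn F' (Ioi 0)) (hFx : IntegrableOn (fun x => F x / x) (Ioi 0)) :
    ∫ x in Ioi 0, F' x = 0 := by
  -- Under `x = e^u` the two hypotheses say that `F(e^u)` and its derivative are integrable on the
  -- line, so no boundary values need be examined.
  have himg : Real.exp '' univ = Ioi 0 := by rw [image_univ, Real.range_exp]
  have hd : ∀ x ∈ (univ : Set ℝ), HasDerivWithinAt Real.exp (Real.exp x) univ x :=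
    fun x _ => (Real.hasDerivAt_exp x).hasDerivWithinAt
  have hinj : InjOn Real.exp univ := Real.exp_injective.injOn
  rw [← himg, integrableOn_image_iff_integrableOn_abs_deriv_smul MeasurableSet.univ hd hinj,
    integrableOn_univ] at hF' hFx
  rw [← himg, integral_image_eq_integral_abs_deriv_smul MeasurableSet.univ hd hinj,
    Measure.restrict_univ]
  refine integral_eq_zero_of_hasDerivAt_of_integrable (f := fun u => F (Real.exp u)) ?_ hF' ?_
  · intro u
    have := (hF _ (Real.exp_pos u)).comp u (Real.hasDerivAt_exp u)
    exact this.congr_deriv (by simp [abs_of_pos (Real.exp_pos u), mul_comm])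
  · convert hFx using 2 with u
    rw [abs_of_pos (Real.exp_pos u), smul_eq_mul]
    have := (Real.exp_pos u).ne'
    field_simp

lemma hasDerivAt_weight {α x : ℝ} (hx : 0 < x) :
    HasDerivAt (weight α) ((α / x - 1) * weight α x) x := by
  have h1 := Real.hasDerivAt_rpow_const (p := α) (Or.inl hx.ne')
  have h2 := (Real.hasDerivAt_exp (-x)).comp x (hasDerivAt_neg x)
  refine (h1.mul h2).congr_deriv ?_
  rw [Real.rpow_sub_one hx.ne', weight]
  simp
  ring

lemma continuousOn_weight (α : ℝ) : ContinuousOn (weight α) (Ioi 0) :=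
  fun _ hx => (hasDerivAt_weight hx).continuousAt.continuousWithinAt

lemma hasDerivAt_pow_mul_weight {α x : ℝ} (hx : 0 < x) (p : ℕ) :
    HasDerivAt (fun x => x ^ (p + 1) * weight α x)
      ((p + 1 + α) * (x ^ p * weight α x) - x ^ (p + 1) * weight α x) x := by
  refine ((hasDerivAt_pow (p + 1) x).mul (hasDerivAt_weight (α := α) hx)).congr_deriv ?_
  rw [Nat.add_sub_cancel]
  push_cast
  field_simp
  ring

/-- The derivative controls one more power of `x`, a Hardy type inequality. -/
theorem integrableOn_pow_succ_mul {α : ℝ} (hα : 0 ≤ α) {g g' : ℝ → ℝ} (p : ℕ)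
    (hg : ∀ x, 0 < x → HasDerivAt g (g' x) x)
    (h0 : IntegrableOn (fun x => x ^ p * (g x * weight α x)) (Ioi 0))
    (h1 : IntegrableOn (fun x => x ^ p * (x * g' x * weight α x)) (Ioi 0)) :
    IntegrableOn (fun x => x ^ (p + 1) * (g x * weight α x)) (Ioi 0) := by
  set V : ℝ → ℝ := fun x => x ^ (p + 1) * weight α x with hV
  -- A differentiable substitute for `|g|`: it satisfies `|g| ≤ s ≤ 1 + |g|` and `|s'| ≤ |g'|`, with
  -- no trouble at the zeros of `g`.
  set s : ℝ → ℝ := fun x => √(1 + g x ^ 2) with hs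
  have hgc : ContinuousOn g (Ioi 0) := fun x hx => (hg x hx).continuousAt.continuousWithinAt
  have hwc := continuousOn_weight α
  have hpos : ∀ x, 0 < 1 + g x ^ 2 := fun x => by positivity
  have hspos : ∀ x, 0 < s x := fun x => Real.sqrt_pos.2 (hpos x)
  have hgs : ∀ x, |g x| ≤ s x := fun x => Real.abs_le_sqrt (by linarith)
  have hsg : ∀ x, s x ≤ 1 + |g x| := by
    intro x
    rw [hs, Real.sqrt_le_left (by positivity)]
    nlinarith [abs_nonneg (g x), sq_abs (g x)]
  have hsc : ContinuousOn s (Ioi 0) :=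
    Real.continuous_sqrt.comp_continuousOn (continuousOn_const.add (hgc.pow 2))
  have hVc : ContinuousOn V (Ioi 0) := (continuousOn_id.pow _).mul hwc
  have hVnn : ∀ x, 0 < x → 0 ≤ V x := fun x hx =>
    mul_nonneg (pow_nonneg hx.le _) (weight_nonneg hx.le)
  have hsd : ∀ x, 0 < x → HasDerivAt s (g x / s x * g' x) x := by
    intro x hx
    refine ((((hg x hx).pow 2).const_add 1).sqrt (hpos x).ne').congr_deriv ?_
    have := (hspos x).ne'
    simp only [hs, Pi.pow_apply] at this ⊢
    field_simp
    push_cast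
    ring
  -- the pieces of the derivative of `s * V`
  have i1 : IntegrableOn (fun x => g x / s x * g' x * V x) (Ioi 0) := by
    have e : ∀ x, g x / s x * g' x * V x = g x / s x * (x ^ p * (x * g' x * weight α x)) := by
      intro x; simp only [hV]; ring
    simp only [e]
    refine Integrable.bdd_mul (c := 1) h1 ?_ ?_
    · exact (hgc.div hsc fun x _ => (hspos x).ne').aestronglyMeasurable measurableSet_Ioi
    · refine Eventually.of_forall fun x => ?_
      rw [Real.norm_eq_abs, abs_div, abs_of_pos (hspos x), div_le_one (hspos x)]
      exact hgs x
  have i2 : IntegrableOn (fun x => s x * (x ^ p * weight α x)) (Ioi 0) := by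
    have hb : IntegrableOn (fun x => x ^ p * weight α x + |x ^ p * (g x * weight α x)|) (Ioi 0) :=
      (integrableOn_pow_mul_weight hα p).add h0.abs
    refine Integrable.mono' hb ?_ ?_
    · exact (hsc.mul ((continuousOn_id.pow _).mul hwc)).aestronglyMeasurable measurableSet_Ioi
    · filter_upwards [ae_restrict_mem measurableSet_Ioi] with x hx
      have hx : 0 < x := hx
      have hu : 0 ≤ x ^ p * weight α x := mul_nonneg (pow_nonneg hx.le _) (weight_nonneg hx.le)
      rw [Real.norm_eq_abs, abs_of_nonneg (mul_nonneg (hspos x).le hu)]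
      have e : |x ^ p * (g x * weight α x)| = |g x| * (x ^ p * weight α x) := by
        rw [show x ^ p * (g x * weight α x) = g x * (x ^ p * weight α x) by ring, abs_mul,
          abs_of_nonneg hu]
      rw [e]
      nlinarith [hsg x]
  have hsub : Ioi (1 : ℝ) ⊆ Ioi 0 := Ioi_subset_Ioi zero_le_one
  -- From `(s V)' = s' V + (p+1+α) s x^p w - s V`, integrated over `[1, R]`, discard `-s(R) V(R) ≤
  -- 0`. The last term `-s V`, due to the decay of `e^(-x)`, is the one that is controlled.
  set C : ℝ := s 1 * V 1 + (∫ x in Ioi 1, |g x / s x * g' x * V x|) +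
    (p + 1 + α) * ∫ x in Ioi 1, s x * (x ^ p * weight α x) with hC
  have hbound : ∀ R : ℝ, 1 ≤ R → ∫ x in (1 : ℝ)..R, s x * V x ≤ C := by
    intro R hR
    have hIcc : uIcc 1 R ⊆ Ioi 0 := by
      rw [uIcc_of_le hR]; intro x hx; exact lt_of_lt_of_le one_pos hx.1
    have hIoc : Ioc 1 R ⊆ Ioi 0 := fun x hx => one_pos.trans hx.1
    have j1 : IntervalIntegrable (fun x => g x / s x * g' x * V x) volume 1 R := by
      rw [intervalIntegrable_iff_integrableOn_Ioc_of_le hR]; exact i1.mono_set hIoc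
    have j2 : IntervalIntegrable (fun x => s x * (x ^ p * weight α x)) volume 1 R := by
      rw [intervalIntegrable_iff_integrableOn_Ioc_of_le hR]; exact i2.mono_set hIoc
    have j3 : IntervalIntegrable (fun x => s x * V x) volume 1 R :=
      ((hsc.mul hVc).mono hIcc).intervalIntegrable
    have hftc := intervalIntegral.integral_eq_sub_of_hasDerivAt (a := 1) (b := R)
      (f := fun x => s x * V x)
      (f' := fun x => g x / s x * g' x * V x + (p + 1 + α) * (s x * (x ^ p * weight α x))
        - s x * V x)
      (fun x hx => by
        refine ((hsd x (hIcc hx)).mul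
          (hasDerivAt_pow_mul_weight (α := α) (hIcc hx) p)).congr_deriv ?_
        simp only [hV]
        ring)
      ((j1.add (j2.const_mul _)).sub j3)
    rw [intervalIntegral.integral_sub (j1.add (j2.const_mul _)) j3,
      intervalIntegral.integral_add j1 (j2.const_mul _),
      intervalIntegral.integral_const_mul] at hftc
    have k1 : ∫ x in (1 : ℝ)..R, g x / s x * g' x * V x ≤
        ∫ x in Ioi 1, |g x / s x * g' x * V x| := by
      rw [intervalIntegral.integral_of_le hR]
      refine (le_abs_self _).trans ((abs_integral_le_integral_abs).trans ?_)
      exact setIntegral_mono_set (i1.mono_set hsub).abs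
        (Eventually.of_forall fun x => abs_nonneg _) (LE.le.eventuallyLE
          fun x hx => hx.1)
    have k2 : ∫ x in (1 : ℝ)..R, s x * (x ^ p * weight α x) ≤
        ∫ x in Ioi 1, s x * (x ^ p * weight α x) := by
      rw [intervalIntegral.integral_of_le hR]
      refine setIntegral_mono_set (i2.mono_set hsub) ?_ (LE.le.eventuallyLE
          fun x hx => hx.1)
      filter_upwards [ae_restrict_mem measurableSet_Ioi] with x hx
      have hx : 0 < x := one_pos.trans hx
      exact mul_nonneg (hspos x).le (mul_nonneg (pow_nonneg hx.le _) (weight_nonneg hx.le))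
    have k3 : 0 ≤ s R * V R := mul_nonneg (hspos R).le (hVnn R (by linarith))
    have k4 := mul_le_mul_of_nonneg_left k2 (show 0 ≤ (p : ℝ) + 1 + α by positivity)
    simp only [hC]
    linarith
  have hmeas : AEStronglyMeasurable (fun x => x ^ (p + 1) * (g x * weight α x))
      (volume.restrict (Ioi 0)) :=
    ((continuousOn_id.pow _).mul (hgc.mul hwc)).aestronglyMeasurable measurableSet_Ioi
  have hinf : IntegrableOn (fun x => x ^ (p + 1) * (g x * weight α x)) (Ioi 1) := by
    have hI : IntegrableOn (fun x => s x * V x) (Ioi 1) := by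
      refine integrableOn_Ioi_of_intervalIntegral_norm_bounded (l := atTop) (b := id) C 1 ?_
        tendsto_id ?_
      · intro R
        exact ((hsc.mul hVc).mono fun x hx => one_pos.trans_le hx.1).integrableOn_Icc.mono_set
          Ioc_subset_Icc_self
      · filter_upwards [eventually_ge_atTop (1 : ℝ)] with R hR
        refine le_trans (le_of_eq ?_) (hbound R hR)
        rw [intervalIntegral.integral_of_le (show (1 : ℝ) ≤ id R from hR),
          intervalIntegral.integral_of_le hR]
        refine setIntegral_congr_fun measurableSet_Ioc fun x hx => ?_
        exact abs_of_nonneg (mul_nonneg (hspos x).le (hVnn x (one_pos.trans hx.1)))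
    refine Integrable.mono' hI (hmeas.mono_set hsub) ?_
    filter_upwards [ae_restrict_mem measurableSet_Ioi] with x hx
    have hx : 0 < x := one_pos.trans hx
    rw [show x ^ (p + 1) * (g x * weight α x) = g x * V x by simp only [hV]; ring,
      Real.norm_eq_abs, abs_mul, abs_of_nonneg (hVnn x hx)]
    exact mul_le_mul_of_nonneg_right (hgs x) (hVnn x hx)
  have hzero : IntegrableOn (fun x => x ^ (p + 1) * (g x * weight α x)) (Ioc 0 1) := by
    refine Integrable.mono (h0.mono_set Ioc_subset_Ioi_self)
      (hmeas.mono_set Ioc_subset_Ioi_self) ?_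
    filter_upwards [ae_restrict_mem measurableSet_Ioc] with x hx
    rw [norm_mul, norm_mul (x ^ p)]
    refine mul_le_mul_of_nonneg_right ?_ (norm_nonneg _)
    rw [Real.norm_of_nonneg (pow_nonneg hx.1.le _), Real.norm_of_nonneg (pow_nonneg hx.1.le _)]
    exact pow_le_pow_of_le_one hx.1.le hx.2 (Nat.le_succ p)
  rw [← Ioc_union_Ioi_eq_Ioi (zero_le_one' ℝ)]
  exact hzero.union hinf

end IntegrationByParts

/-! ### Passing between integrability against monomials and against Laguerre polynomials. -/

section LaguerreIntegrals

variable {μ : Measure ℝ} {φ : ℝ → ℝ} {α : ℝ}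

lemma laguerreCoeff_self_ne_zero (hα : 0 ≤ α) (n : ℕ) : laguerreCoeff α n n ≠ 0 := by
  rw [laguerreCoeff, if_pos le_rfl]
  have := (gamma_pos hα n).ne'
  have h : ((n - n).factorial : ℝ) ≠ 0 := by positivity
  have h' : (n.factorial : ℝ) ≠ 0 := by positivity
  have h1 : ((-1 : ℝ)) ^ n ≠ 0 := pow_ne_zero _ (by norm_num)
  positivity

/-- The change of basis is triangular with nonzero diagonal `laguerreCoeff α i i`. -/
lemma integrable_pow_mul_of_laguerre (hα : 0 ≤ α) {n : ℕ}
    (h : ∀ a ≤ n, Integrable (fun x => laguerre α a x * φ x) μ) :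
    ∀ i ≤ n, Integrable (fun x => x ^ i * φ x) μ := by
  intro i
  induction i using Nat.strong_induction_on with
  | _ i ih =>
    intro hi
    have hc := laguerreCoeff_self_ne_zero hα i
    have e : (fun x => x ^ i * φ x) = fun x => (laguerreCoeff α i i)⁻¹ * (laguerre α i x * φ x -
        ∑ k ∈ Finset.range i, laguerreCoeff α i k * (x ^ k * φ x)) := by
      funext x
      rw [laguerre_eq_sum, Finset.sum_range_succ, add_mul, Finset.sum_mul]
      simp only [mul_assoc]
      field_simp
      ring
    rw [e]
    refine ((h i hi).sub (integrable_finsetSum _ fun k hk => ?_)).const_mul _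
    have := Finset.mem_range.1 hk
    exact (ih k this (by omega)).const_mul _

lemma integrable_laguerre_mul_of_pow {n : ℕ} (h : ∀ i ≤ n, Integrable (fun x => x ^ i * φ x) μ) :
    Integrable (fun x => laguerre α n x * φ x) μ := by
  have e : (fun x => laguerre α n x * φ x) = fun x =>
      ∑ k ∈ Finset.range (n + 1), laguerreCoeff α n k * (x ^ k * φ x) := by
    funext x
    rw [laguerre_eq_sum, Finset.sum_mul]
    simp only [mul_assoc]
  rw [e]
  refine integrable_finsetSum _ fun k hk => ?_
  exact (h k (Finset.mem_range_succ_iff.1 hk)).const_mul _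

/-- Apply the change of basis in each factor and split `x^p` into two powers of exponent at most
`n`. -/
lemma integrable_pow_mul_of_laguerre_mul_laguerre (hα : 0 ≤ α) {n : ℕ}
    (h : ∀ a ≤ n, ∀ b ≤ n, Integrable (fun x => laguerre α a x * (laguerre α b x * φ x)) μ)
    {p : ℕ} (hp : p ≤ 2 * n) : Integrable (fun x => x ^ p * φ x) μ := by
  have h1 : ∀ i ≤ n, ∀ b ≤ n, Integrable (fun x => laguerre α b x * (x ^ i * φ x)) μ := by
    intro i hi b hb
    have := integrable_pow_mul_of_laguerre hα (fun a ha => h a ha b hb) i hi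
    refine this.congr (Filter.Eventually.of_forall fun x => ?_)
    simp only
    ring
  have h2 := integrable_pow_mul_of_laguerre hα (fun b hb => h1 (min p n) (min_le_right _ _) b hb)
    (p - min p n) (by omega)
  refine h2.congr (Filter.Eventually.of_forall fun x => ?_)
  simp only
  rw [← mul_assoc, ← pow_add]
  congr 2
  omega

lemma integrable_laguerre_mul_laguerre_of_pow {n a b : ℕ}
    (h : ∀ i ≤ n, Integrable (fun x => x ^ i * φ x) μ) (hab : a + b ≤ n) :
    Integrable (fun x => laguerre α a x * (laguerre α b x * φ x)) μ := by
  refine integrable_laguerre_mul_of_pow fun i hi => ?_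
  have : Integrable (fun x => laguerre α b x * (x ^ i * φ x)) μ := by
    refine integrable_laguerre_mul_of_pow fun j hj => ?_
    refine (h (j + i) (by omega)).congr (Filter.Eventually.of_forall fun x => ?_)
    simp only
    ring
  refine this.congr (Filter.Eventually.of_forall fun x => ?_)
  simp only
  ring

end LaguerreIntegrals

/-! ### Integration by parts against products of Laguerre polynomials. -/

section Commutator

variable {α : ℝ} {g g' : ℝ → ℝ} {n : ℕ}

/-- Integrability against one more Laguerre polynomial than assumed. -/
theorem integrableOn_laguerre_mul_laguerre (hα : 0 ≤ α)
    (hg : ∀ x, 0 < x → HasDerivAt g (g' x) x)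
    (h0 : ∀ a ≤ n, ∀ b ≤ n, IntegrableOn
      (fun x => laguerre α a x * (laguerre α b x * (g x * weight α x))) (Ioi 0))
    (h1 : ∀ a ≤ n, ∀ b ≤ n, IntegrableOn
      (fun x => laguerre α a x * (laguerre α b x * (x * g' x * weight α x))) (Ioi 0))
    {a b : ℕ} (hab : a + b ≤ 2 * n + 1) :
    IntegrableOn (fun x => laguerre α a x * (laguerre α b x * (g x * weight α x))) (Ioi 0) := by
  have k0 := fun p (hp : p ≤ 2 * n) => integrable_pow_mul_of_laguerre_mul_laguerre hα h0 hp
  have k1 := integrable_pow_mul_of_laguerre_mul_laguerre hα h1 le_rfl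
  have k2 := integrableOn_pow_succ_mul hα (2 * n) hg (k0 _ le_rfl) k1
  refine integrable_laguerre_mul_laguerre_of_pow (fun i hi => ?_) hab
  rcases hi.lt_or_eq with h | h
  · exact k0 i (by omega)
  · subst h; exact k2

lemma integrableOn_laguerreShift_mul (hα : 0 ≤ α)
    (hg : ∀ x, 0 < x → HasDerivAt g (g' x) x)
    (h0 : ∀ a ≤ n, ∀ b ≤ n, IntegrableOn
      (fun x => laguerre α a x * (laguerre α b x * (g x * weight α x))) (Ioi 0))
    (h1 : ∀ a ≤ n, ∀ b ≤ n, IntegrableOn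
      (fun x => laguerre α a x * (laguerre α b x * (x * g' x * weight α x))) (Ioi 0))
    {a b : ℕ} (ha : a ≤ n) (hb : b ≤ n) :
    IntegrableOn (fun x => laguerreShift α a x * (laguerre α b x * (g x * weight α x)))
      (Ioi 0) := by
  have hI := fun {a b : ℕ} (h : a + b ≤ 2 * n + 1) =>
    integrableOn_laguerre_mul_laguerre hα hg h0 h1 h
  have e : ∀ x, laguerreShift α a x * (laguerre α b x * (g x * weight α x)) =
      (a + 1) * (laguerre α (a + 1) x * (laguerre α b x * (g x * weight α x))) -
      (if a = 0 then 0 else (a + α)) *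
        (laguerre α (a - 1) x * (laguerre α b x * (g x * weight α x))) := by
    intro x
    rw [laguerreShift]
    split_ifs <;> ring
  simp only [e]
  exact ((hI (by omega)).const_mul _).sub ((hI (by omega)).const_mul _)

/-- Integration by parts for the operator `x d/dx`. -/
theorem integral_euler_mul_laguerre (hα : 0 ≤ α)
    (hg : ∀ x, 0 < x → HasDerivAt g (g' x) x)
    (h0 : ∀ a ≤ n, ∀ b ≤ n, IntegrableOn
      (fun x => laguerre α a x * (laguerre α b x * (g x * weight α x))) (Ioi 0))
    (h1 : ∀ a ≤ n, ∀ b ≤ n, IntegrableOn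
      (fun x => laguerre α a x * (laguerre α b x * (x * g' x * weight α x))) (Ioi 0))
    {a b : ℕ} (ha : a ≤ n) (hb : b ≤ n) :
    ∫ x in Ioi 0, laguerre α a x * (laguerre α b x * (x * g' x * weight α x)) =
      -(1 / 2) * ((∫ x in Ioi 0, laguerreShift α a x * (laguerre α b x * (g x * weight α x))) +
        ∫ x in Ioi 0, laguerreShift α b x * (laguerre α a x * (g x * weight α x))) := by
  have i1 := integrableOn_laguerreShift_mul hα hg h0 h1 ha hb
  have i2 := integrableOn_laguerreShift_mul hα hg h0 h1 hb ha
  have i3 := h1 a ha b hb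
  have hd : ∀ c x, HasDerivAt (laguerre α c)
      ((Polynomial.derivative (laguerrePoly α c)).eval x) x := by
    intro c x
    have := (laguerrePoly α c).hasDerivAt x
    simpa only [funext (eval_laguerrePoly α c)] using this
  -- Splitting `(x w)' = (α + 1 - x) w` evenly between the two polynomials turns `(x L_a L_b w)'`
  -- into half the sum of the two `laguerreShift` terms.
  have key := integral_Ioi_deriv_eq_zero
    (F := fun x => x * (laguerre α a x * (laguerre α b x * (g x * weight α x))))
    (F' := fun x => laguerre α a x * (laguerre α b x * (x * g' x * weight α x)) +
      ((1 / 2) * (laguerreShift α a x * (laguerre α b x * (g x * weight α x))) +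
        (1 / 2) * (laguerreShift α b x * (laguerre α a x * (g x * weight α x)))))
    (fun x hx => by
      refine ((hasDerivAt_id x).mul ((hd a x).mul ((hd b x).mul
        ((hg x hx).mul (hasDerivAt_weight (α := α) hx))))).congr_deriv ?_
      simp only [id_eq, Pi.mul_apply, ← laguerreShift_eq hα]
      field_simp
      ring)
    (i3.add ((i1.const_mul _).add (i2.const_mul _)))
    ((h0 a ha b hb).congr_fun (fun x hx => by
      have : x ≠ 0 := ne_of_gt hx
      simp only
      field_simp) measurableSet_Ioi)
  have e1 := integral_add i3 ((i1.const_mul (1 / 2)).add (i2.const_mul (1 / 2)))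
  have e2 := integral_add (i1.const_mul (1 / 2)) (i2.const_mul (1 / 2))
  simp only [Pi.add_apply] at e1
  rw [e1, e2, integral_const_mul, integral_const_mul] at key
  linarith

end Commutator

/-! ### Andréief's identity and the domination by the one-point marginal. -/

section Andreief

variable {m : ℕ} {ν : Measure ℝ} [SigmaFinite ν] {φ ψ : Fin m → ℝ → ℝ}

/-- The product of the determinants `det φ_a(x_i)` and `det ψ_a(x_i)`. -/
def detProduct (φ ψ : Fin m → ℝ → ℝ) (x : Fin m → ℝ) : ℝ :=
  (Matrix.of fun i a => φ a (x i)).det * (Matrix.of fun i a => ψ a (x i)).det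

/-- The sign of a permutation as a real number. -/
def realSign (σ : Equiv.Perm (Fin m)) : ℝ := ((Equiv.Perm.sign σ : ℤ) : ℝ)

lemma realSign_mul_self (σ : Equiv.Perm (Fin m)) : realSign σ * realSign σ = 1 := by
  rw [realSign, ← Int.cast_mul, ← Units.val_mul, Int.units_mul_self]
  simp

lemma detProduct_eq (x : Fin m → ℝ) :
    detProduct φ ψ x = ∑ σ : Equiv.Perm (Fin m), ∑ τ : Equiv.Perm (Fin m),
      realSign σ * realSign τ * ∏ i, (ψ (τ i) (x i) * φ (σ i) (x i)) := by
  have h : ∀ χ : Fin m → ℝ → ℝ, (Matrix.of fun i a => χ a (x i)).det =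
      ∑ σ : Equiv.Perm (Fin m), realSign σ * ∏ i, χ (σ i) (x i) := by
    intro χ
    rw [← Matrix.det_transpose, Matrix.det_apply']
    rfl
  rw [detProduct, h φ, h ψ, Finset.sum_mul_sum]
  refine Finset.sum_congr rfl fun σ _ => Finset.sum_congr rfl fun τ _ => ?_
  rw [Finset.prod_mul_distrib]
  ring

lemma prod_mul_detProduct (h : Fin m → ℝ → ℝ) (x : Fin m → ℝ) :
    (∏ i, h i (x i)) * detProduct φ ψ x =
      ∑ σ : Equiv.Perm (Fin m), ∑ τ : Equiv.Perm (Fin m),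
        realSign σ * realSign τ * ∏ i, (h i (x i) * (ψ (τ i) (x i) * φ (σ i) (x i))) := by
  rw [detProduct_eq, Finset.mul_sum]
  refine Finset.sum_congr rfl fun σ _ => ?_
  rw [Finset.mul_sum]
  refine Finset.sum_congr rfl fun τ _ => ?_
  simp only [Finset.prod_mul_distrib]
  ring

/-- Andréief's identity before symmetrization. -/
theorem integral_prod_mul_detProduct {h : Fin m → ℝ → ℝ}
    (hh : ∀ i a b, Integrable (fun x => h i x * (ψ a x * φ b x)) ν) :
    Integrable (fun x => (∏ i, h i (x i)) * detProduct φ ψ x) (Measure.pi fun _ => ν) ∧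
    ∫ x, (∏ i, h i (x i)) * detProduct φ ψ x ∂(Measure.pi fun _ => ν) =
      ∑ σ : Equiv.Perm (Fin m), ∑ τ : Equiv.Perm (Fin m),
        realSign σ * realSign τ * ∏ i, ∫ x, h i x * (ψ (τ i) x * φ (σ i) x) ∂ν := by
  simp only [prod_mul_detProduct]
  have hI : ∀ σ τ : Equiv.Perm (Fin m), Integrable (fun x : Fin m → ℝ =>
      realSign σ * realSign τ * ∏ i, (h i (x i) * (ψ (τ i) (x i) * φ (σ i) (x i))))
      (Measure.pi fun _ => ν) := fun σ τ =>
    (Integrable.fintype_prod (f := fun i x => h i x * (ψ (τ i) x * φ (σ i) x))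
      fun i => hh i (τ i) (σ i)).const_mul _
  refine ⟨integrable_finsetSum _ fun σ _ => integrable_finsetSum _ fun τ _ => hI σ τ, ?_⟩
  rw [integral_finsetSum _ fun σ _ => integrable_finsetSum _ fun τ _ => hI σ τ]
  refine Finset.sum_congr rfl fun σ _ => ?_
  rw [integral_finsetSum _ fun τ _ => hI σ τ]
  refine Finset.sum_congr rfl fun τ _ => ?_
  rw [integral_const_mul, integral_fintype_prod_eq_prod
    (f := fun i x => h i x * (ψ (τ i) x * φ (σ i) x))]

variable {ι : Type*} [DecidableEq ι]

lemma sqfreeCoeff_prod_sqfreeSeries {κ : Type*} [DecidableEq κ] (s : Finset κ)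
    (y : κ → ι → ℝ) (S : Finset ι) :
    sqfreeCoeff S (∏ i ∈ s, sqfreeSeries fun T => ∏ j ∈ T, y i j) =
      ∏ j ∈ S, ∑ i ∈ s, y i j := by
  induction s using Finset.induction_on generalizing S with
  | empty =>
    rw [Finset.prod_empty, sqfreeCoeff_one]
    split_ifs with h
    · simp [h]
    · obtain ⟨j, hj⟩ := Finset.nonempty_iff_ne_empty.2 h
      exact (Finset.prod_eq_zero hj (by simp)).symm
  | insert a s ha ih =>
    rw [Finset.prod_insert ha, sqfreeCoeff_mul]
    simp only [Finset.sum_insert ha, sqfreeCoeff_sqfreeSeries, ih]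
    rw [Finset.prod_add]

/-- Andréief's identity for the generating series of products of linear statistics. -/
theorem integral_prod_sum_mul_detProduct {f : ι → ℝ → ℝ}
    (hf : ∀ (T : Finset ι) a b, Integrable (fun x => (∏ j ∈ T, f j x) * (ψ a x * φ b x)) ν)
    (S : Finset ι) :
    ∫ x, (∏ j ∈ S, ∑ i, f j (x i)) * detProduct φ ψ x ∂(Measure.pi fun _ => ν) =
      m.factorial * sqfreeCoeff S (Matrix.of fun a b => sqfreeSeries fun T =>
        ∫ x, (∏ j ∈ T, f j x) * (ψ a x * φ b x) ∂ν).det := by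
  -- the coefficient of `∏ i, h (x i)` at `l`
  let H : (ι →₀ ℕ) → ℝ → ℝ := fun d x =>
    MvPowerSeries.coeff d (sqfreeSeries fun T => ∏ j ∈ T, f j x)
  have hH : ∀ d a b, Integrable (fun x => H d x * (ψ a x * φ b x)) ν ∧
      ∫ x, H d x * (ψ a x * φ b x) ∂ν = MvPowerSeries.coeff d (sqfreeSeries fun T =>
        ∫ x, (∏ j ∈ T, f j x) * (ψ a x * φ b x) ∂ν) := by
    intro d a b
    simp only [H, coeff_sqfreeSeries]
    split_ifs with h
    · exact ⟨hf _ a b, rfl⟩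
    · simp
  -- Expanding the product assigns each `j ∈ S` to one variable `x i`; `l` records how the
  -- squarefree monomial is distributed.
  have e1 : ∀ x : Fin m → ℝ, (∏ j ∈ S, ∑ i, f j (x i)) * detProduct φ ψ x =
      ∑ l ∈ Finset.finsuppAntidiag Finset.univ (sqfreeExp S),
        (∏ i, H (l i) (x i)) * detProduct φ ψ x := by
    intro x
    rw [← sqfreeCoeff_prod_sqfreeSeries Finset.univ (fun i j => f j (x i)), sqfreeCoeff,
      MvPowerSeries.coeff_prod, Finset.sum_mul]
  simp only [e1]
  have e2 := fun l : Fin m →₀ (ι →₀ ℕ) => integral_prod_mul_detProduct (φ := φ) (ψ := ψ)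
    (ν := ν) (h := fun i => H (l i)) fun i a b => (hH (l i) a b).1
  rw [integral_finsetSum _ fun l _ => (e2 l).1]
  simp only [(e2 _).2, (hH _ _ _).2]
  set A : Matrix (Fin m) (Fin m) (MvPowerSeries ι ℝ) := Matrix.of fun a b =>
    sqfreeSeries fun T => ∫ x, (∏ j ∈ T, f j x) * (ψ a x * φ b x) ∂ν with hA
  have e3 : ∀ σ τ : Equiv.Perm (Fin m), sqfreeCoeff S (∏ i, A (τ i) (σ i)) =
      ∑ l ∈ Finset.finsuppAntidiag Finset.univ (sqfreeExp S),
        ∏ i, MvPowerSeries.coeff (l i) (A (τ i) (σ i)) := by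
    intro σ τ
    rw [sqfreeCoeff, MvPowerSeries.coeff_prod]
  have e4 : ∑ l ∈ Finset.finsuppAntidiag Finset.univ (sqfreeExp S),
      ∑ σ : Equiv.Perm (Fin m), ∑ τ : Equiv.Perm (Fin m), realSign σ * realSign τ *
        ∏ i, MvPowerSeries.coeff (l i) (A (τ i) (σ i)) =
      ∑ σ : Equiv.Perm (Fin m), ∑ τ : Equiv.Perm (Fin m), realSign σ * realSign τ *
        sqfreeCoeff S (∏ i, A (τ i) (σ i)) := by
    rw [Finset.sum_comm]
    refine Finset.sum_congr rfl fun σ _ => ?_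
    rw [Finset.sum_comm]
    refine Finset.sum_congr rfl fun τ _ => ?_
    rw [e3, Finset.mul_sum]
  refine e4.trans ?_
  -- Permuting the columns by `σ` costs its sign, which cancels the prefactor; hence all `m!`
  -- choices of `σ` contribute the same determinant.
  have e5 : ∀ σ : Equiv.Perm (Fin m), ∑ τ : Equiv.Perm (Fin m), realSign σ * realSign τ *
      sqfreeCoeff S (∏ i, A (τ i) (σ i)) = sqfreeCoeff S A.det := by
    intro σ
    have hdet : A.det = realSign σ • (A.submatrix id σ).det := by
      rw [Matrix.det_permute', ← zsmul_eq_mul, realSign, Int.cast_smul_eq_zsmul, smul_smul,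
        ← Units.val_mul, Int.units_mul_self]
      simp
    rw [hdet, map_smul, Matrix.det_apply, map_sum, Finset.smul_sum]
    refine Finset.sum_congr rfl fun τ _ => ?_
    rw [Units.smul_def, ← Int.cast_smul_eq_zsmul ℝ, map_smul, smul_eq_mul, smul_eq_mul, mul_assoc]
    rfl
  rw [Finset.sum_congr rfl fun σ _ => e5 σ, Finset.sum_const, Finset.card_univ,
    Fintype.card_perm, Fintype.card_fin, nsmul_eq_mul]

/-- The one-point marginal dominates each `ψ_a φ_a`. -/
theorem integral_mul_le_integral_eval {h : ℝ → ℝ} (hh0 : ∀ x, 0 ≤ h x)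
    (hh : ∀ a b, Integrable (fun x => h x * (ψ a x * φ b x)) ν)
    (h1 : ∀ a b, Integrable (fun x => ψ a x * φ b x) ν)
    (ho : ∀ a b, ∫ x, ψ a x * φ b x ∂ν = if a = b then 1 else 0)
    (hnn : ∀ a x, 0 ≤ ψ a x * φ a x) (k a : Fin m) :
    Integrable (fun x => h (x k) * detProduct φ ψ x) (Measure.pi fun _ => ν) ∧
    ∫ x, h x * (ψ a x * φ a x) ∂ν ≤
      ∫ x, h (x k) * detProduct φ ψ x ∂(Measure.pi fun _ => ν) := by
  let H : Fin m → ℝ → ℝ := fun i x => if i = k then h x else 1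
  have hH : ∀ i a b, Integrable (fun x => H i x * (ψ a x * φ b x)) ν := by
    intro i a b
    by_cases hi : i = k
    · simpa [H, hi] using hh a b
    · simpa [H, hi] using h1 a b
  have e : ∀ x : Fin m → ℝ, ∏ i, H i (x i) = h (x k) := by
    intro x
    simp [H]
  obtain ⟨hI, key⟩ := integral_prod_mul_detProduct hH
  simp only [e] at hI key
  refine ⟨hI, ?_⟩
  rw [key]
  have e2 : ∀ σ τ : Equiv.Perm (Fin m), ∏ i, ∫ x, H i x * (ψ (τ i) x * φ (σ i) x) ∂ν =
      if τ = σ then ∫ x, h x * (ψ (σ k) x * φ (σ k) x) ∂ν else 0 := by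
    intro σ τ
    have e3 : ∀ i, i ≠ k → ∫ x, H i x * (ψ (τ i) x * φ (σ i) x) ∂ν =
        if τ i = σ i then 1 else 0 := by
      intro i hi
      simp only [H, if_neg hi, one_mul, ho]
    rw [← Finset.mul_prod_erase _ _ (Finset.mem_univ k),
      Finset.prod_congr rfl fun i hi => e3 i (Finset.ne_of_mem_erase hi)]
    split_ifs with hτ
    · subst hτ
      simp [H]
    -- Permutations that agree away from `k` also agree at `k`, so distinct ones meet a vanishing
    -- orthogonality integral at some other index.
    · obtain ⟨i, hik, hi⟩ : ∃ i, i ≠ k ∧ τ i ≠ σ i := by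
        by_contra hc
        push Not at hc
        apply hτ
        ext1 i
        by_cases hik : i = k
        · subst hik
          by_contra hne
          have h4 : σ.symm (τ i) ≠ i := by
            intro h
            apply hne
            rw [← h, Equiv.apply_symm_apply, h]
          have h5 := hc _ h4
          rw [Equiv.apply_symm_apply] at h5
          exact h4 (τ.injective h5)
        · exact hc i hik
      rw [Finset.prod_eq_zero (Finset.mem_erase.2 ⟨hik, Finset.mem_univ i⟩), mul_zero]
      rw [if_neg hi]
  simp only [e2, mul_ite, mul_zero, Finset.sum_ite_eq', Finset.mem_univ, if_true,
    realSign_mul_self, one_mul]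
  have hpos : ∀ b, 0 ≤ ∫ x, h x * (ψ b x * φ b x) ∂ν := fun b =>
    integral_nonneg fun x => mul_nonneg (hh0 x) (hnn b x)
  -- Of the nonnegative diagonal terms keep one whose permutation sends `k` to `a`.
  have := Finset.single_le_sum (f := fun σ : Equiv.Perm (Fin m) =>
    ∫ x, h x * (ψ (σ k) x * φ (σ k) x) ∂ν) (fun σ _ => hpos (σ k))
    (Finset.mem_univ (Equiv.swap k a))
  simpa using this

end Andreief

/-! ### The ensemble in terms of Laguerre functions. -/

section Ensemble

variable {m : ℕ} {α : ℝ}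

/-- Lebesgue measure on `(0, ∞)`. -/
def halfLine : Measure ℝ := volume.restrict (Ioi 0)

instance : SigmaFinite halfLine := by unfold halfLine; infer_instance

/-- The Laguerre functions `√w * L_a`. -/
def phi (α : ℝ) (a : ℕ) (x : ℝ) : ℝ := √(weight α x) * laguerre α a x

/-- The reciprocal squared norm of `phi α a`. -/
def invNormSq (α : ℝ) (a : ℕ) : ℝ := (a.factorial : ℝ) / Real.Gamma (a + α + 1)

/-- The functions dual to `phi`. -/
def psi (α : ℝ) (a : ℕ) (x : ℝ) : ℝ := invNormSq α a * phi α a x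

lemma invNormSq_pos (hα : 0 ≤ α) (a : ℕ) : 0 < invNormSq α a :=
  div_pos (by positivity) (gamma_pos hα a)

lemma ae_halfLine {p : ℝ → Prop} (h : ∀ x, 0 < x → p x) : ∀ᵐ x ∂halfLine, p x := by
  filter_upwards [ae_restrict_mem measurableSet_Ioi] with x hx using h x hx

lemma psi_mul_phi {x : ℝ} (hx : 0 < x) (a b : ℕ) :
    psi α a x * phi α b x = invNormSq α a * (laguerre α a x * (laguerre α b x * weight α x)) := by
  rw [psi, phi, phi]
  nth_rewrite 3 [← Real.mul_self_sqrt (weight_nonneg (α := α) hx.le)]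
  ring

lemma continuous_laguerre (α : ℝ) (a : ℕ) : Continuous (laguerre α a) := by
  have := (laguerrePoly α a).continuous
  simpa only [funext (eval_laguerrePoly α a)] using this

lemma measurable_weight (α : ℝ) : Measurable (weight α) :=
  (measurable_id.pow_const α).mul (Real.measurable_exp.comp measurable_neg)

lemma measurable_phi (α : ℝ) (a : ℕ) : Measurable (phi α a) :=
  (measurable_weight α).sqrt.mul (continuous_laguerre α a).measurable

lemma measurable_psi (α : ℝ) (a : ℕ) : Measurable (psi α a) :=
  (measurable_phi α a).const_mul _

lemma integrable_mul_psi_mul_phi_iff (hα : 0 ≤ α) (g : ℝ → ℝ) (a b : ℕ) :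
    Integrable (fun x => g x * (psi α a x * phi α b x)) halfLine ↔
      IntegrableOn (fun x => laguerre α a x * (laguerre α b x * (g x * weight α x))) (Ioi 0) := by
  have h1 : (fun x => g x * (psi α a x * phi α b x)) =ᵐ[halfLine] fun x =>
      invNormSq α a * (laguerre α a x * (laguerre α b x * (g x * weight α x))) :=
    ae_halfLine fun x hx => by simp only [psi_mul_phi hx]; ring
  rw [integrable_congr h1, IntegrableOn, halfLine]
  exact integrable_const_mul_iff (invNormSq_pos hα a).ne'.isUnit _

lemma integral_mul_psi_mul_phi (g : ℝ → ℝ) (a b : ℕ) :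
    ∫ x, g x * (psi α a x * phi α b x) ∂halfLine =
      invNormSq α a * ∫ x in Ioi 0, laguerre α a x * (laguerre α b x * (g x * weight α x)) := by
  rw [← integral_const_mul]
  refine integral_congr_ae (ae_halfLine fun x hx => ?_)
  simp only [psi_mul_phi hx]
  ring

lemma integrable_psi_mul_phi (hα : 0 ≤ α) (a b : ℕ) :
    Integrable (fun x => psi α a x * phi α b x) halfLine := by
  have h : Integrable (fun x => (1 : ℝ) * (psi α a x * phi α b x)) halfLine := by
    rw [integrable_mul_psi_mul_phi_iff hα (fun _ => 1)]
    refine integrable_laguerre_mul_laguerre_of_pow (n := a + b) (fun i _ => ?_) le_rfl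
    simp only [one_mul]
    exact integrableOn_pow_mul_weight hα i
  simpa using h

lemma integral_psi_mul_phi (hα : 0 ≤ α) (a b : ℕ) :
    ∫ x, psi α a x * phi α b x ∂halfLine = if a = b then 1 else 0 := by
  have h := integral_mul_psi_mul_phi (α := α) (fun _ => 1) a b
  simp only [one_mul, ← mul_assoc] at h
  rw [h, integral_laguerre_mul hα, invNormSq]
  split_ifs
  · have := (gamma_pos hα a).ne'
    have : (a.factorial : ℝ) ≠ 0 := by positivity
    field_simp
  · simp

lemma psi_mul_phi_nonneg (hα : 0 ≤ α) (a : ℕ) (x : ℝ) : 0 ≤ psi α a x * phi α a x := by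
  rw [psi, mul_assoc]
  exact mul_nonneg (invNormSq_pos hα a).le (mul_self_nonneg _)

/-- The product of the Laguerre determinants. -/
def laguerreDet (m : ℕ) (α : ℝ) : (Fin m → ℝ) → ℝ :=
  detProduct (fun a : Fin m => phi α a) (fun a : Fin m => psi α a)

lemma laguerreDet_eq (x : Fin m → ℝ) :
    laguerreDet m α x = (∏ a : Fin m, invNormSq α a) *
      (Matrix.of fun i (a : Fin m) => phi α a (x i)).det ^ 2 := by
  have h := Matrix.det_mul_row (fun a : Fin m => invNormSq α a)
    (Matrix.of fun i (a : Fin m) => phi α a (x i))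
  rw [laguerreDet, detProduct]
  change _ * (Matrix.of fun i (j : Fin m) => invNormSq α j * phi α j (x i)).det = _
  simp only [Matrix.of_apply] at h
  rw [h]
  ring

lemma laguerreDet_nonneg (hα : 0 ≤ α) (x : Fin m → ℝ) : 0 ≤ laguerreDet m α x := by
  rw [laguerreDet_eq]
  exact mul_nonneg (Finset.prod_nonneg fun a _ => (invNormSq_pos hα a).le) (sq_nonneg _)

/-- Dividing each column by its leading coefficient leaves monic polynomials of degrees `0, …, m-1`,
whose determinant is Vandermonde. -/
lemma det_laguerre (hα : 0 ≤ α) (x : Fin m → ℝ) :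
    (Matrix.of fun i (a : Fin m) => laguerre α a (x i)).det =
      (∏ a : Fin m, laguerreCoeff α a a) * ∏ i, ∏ j ∈ Finset.Ioi i, (x j - x i) := by
  have hc := fun a : ℕ => laguerreCoeff_self_ne_zero hα a
  have hdeg : ∀ a, (laguerrePoly α a).natDegree = a := by
    intro a
    refine Polynomial.natDegree_eq_of_le_of_coeff_ne_zero ?_ ?_
    · rw [Polynomial.natDegree_le_iff_coeff_eq_zero]
      intro k hk
      rw [coeff_laguerrePoly, laguerreCoeff, if_neg (by omega)]
    · rw [coeff_laguerrePoly]; exact hc a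
  let p : Fin m → Polynomial ℝ := fun a =>
    Polynomial.C (laguerreCoeff α a a)⁻¹ * laguerrePoly α a
  have h1 := Matrix.det_eval_matrixOfPolynomials_eq_det_vandermonde x p
    (fun a => by
      rw [Polynomial.natDegree_C_mul (inv_ne_zero (hc a)), hdeg])
    (fun a => by
      rw [Polynomial.Monic, Polynomial.leadingCoeff_mul, Polynomial.leadingCoeff_C,
        Polynomial.leadingCoeff, hdeg, coeff_laguerrePoly, inv_mul_cancel₀ (hc a)])
  have h2 := Matrix.det_mul_row (fun a : Fin m => laguerreCoeff α a a)
    (Matrix.of fun i a => (p a).eval (x i))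
  rw [← Matrix.det_vandermonde, h1, ← h2]
  congr 1
  ext i a
  simp only [Matrix.of_apply, p, Polynomial.eval_mul, Polynomial.eval_C, eval_laguerrePoly]
  rw [← mul_assoc, mul_inv_cancel₀ (hc a), one_mul]

/-- The ratio of `density` and `laguerreDet`. -/
def densityConst (m : ℕ) (α : ℝ) : ℝ :=
  ((∏ a : Fin m, invNormSq α a) * (∏ a : Fin m, laguerreCoeff α a a) ^ 2)⁻¹

lemma densityConst_pos (hα : 0 ≤ α) : 0 < densityConst m α := by
  have h1 : 0 < ∏ a : Fin m, invNormSq α a := Finset.prod_pos fun a _ => invNormSq_pos hα a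
  have h2 : ∏ a : Fin m, laguerreCoeff α a a ≠ 0 :=
    Finset.prod_ne_zero_iff.2 fun a _ => laguerreCoeff_self_ne_zero hα a
  rw [densityConst]
  positivity

lemma density_eq (hα : 0 ≤ α) {x : Fin m → ℝ} (hx : ∀ i, 0 < x i) :
    density m α x = densityConst m α * laguerreDet m α x := by
  have h1 : ∏ a : Fin m, invNormSq α a ≠ 0 :=
    (Finset.prod_pos fun (a : Fin m) _ => invNormSq_pos hα a).ne'
  have h2 : ∏ a : Fin m, laguerreCoeff α a a ≠ 0 :=
    Finset.prod_ne_zero_iff.2 fun a _ => laguerreCoeff_self_ne_zero hα a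
  have h3 := Matrix.det_mul_column (fun i : Fin m => √(weight α (x i)))
    (Matrix.of fun i (a : Fin m) => laguerre α a (x i))
  simp only [Matrix.of_apply] at h3
  rw [laguerreDet_eq]
  change _ = _ * (_ * (Matrix.of fun i (a : Fin m) =>
    √(weight α (x i)) * laguerre α a (x i)).det ^ 2)
  rw [h3, det_laguerre hα, mul_pow, mul_pow, ← Finset.prod_pow,
    Finset.prod_congr rfl fun i _ => Real.sq_sqrt (weight_nonneg (α := α) (hx i).le),
    densityConst, density]
  have h4 : (∏ i : Fin m, ∏ j ∈ Finset.Ioi i, (x j - x i)) ^ 2 =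
      ∏ i : Fin m, ∏ j ∈ Finset.Ioi i, (x i - x j) ^ 2 := by
    rw [← Finset.prod_pow]
    refine Finset.prod_congr rfl fun i _ => ?_
    rw [← Finset.prod_pow]
    exact Finset.prod_congr rfl fun j _ => by ring
  rw [h4]
  field_simp

lemma ae_pi_halfLine {κ : Type*} [Fintype κ] {p : (κ → ℝ) → Prop} (h : ∀ x, (∀ i, 0 < x i) → p x) :
    ∀ᵐ x ∂(Measure.pi fun _ : κ => halfLine), p x := by
  have : ∀ᵐ x ∂(Measure.pi fun _ : κ => halfLine), ∀ i, 0 < x i := by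
    rw [ae_all_iff]
    intro i
    exact Measure.quasiMeasurePreserving_eval (fun _ : κ => halfLine) i |>.ae
      (ae_halfLine fun x hx => hx)
  filter_upwards [this] with x hx using h x hx

lemma volume_restrict_pi_Ioi {κ : Type*} [Fintype κ] :
    (volume : Measure (κ → ℝ)).restrict (univ.pi fun _ => Ioi (0 : ℝ)) =
      Measure.pi fun _ => halfLine := by
  rw [volume_pi, Measure.restrict_pi_pi]
  rfl

lemma measurable_laguerreDet : Measurable (laguerreDet m α) := by
  have h : ∀ x, laguerreDet m α x = _ := fun x => detProduct_eq x
  rw [funext h]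
  refine Finset.measurable_fun_sum _ fun σ _ => Finset.measurable_fun_sum _ fun τ _ =>
    Measurable.const_mul (Finset.measurable_fun_prod _ fun i _ => ?_) _
  exact ((measurable_psi α _).comp (measurable_pi_apply i)).mul
    ((measurable_phi α _).comp (measurable_pi_apply i))

lemma unnormalized_eq (hα : 0 ≤ α) : unnormalized m α =
    (Measure.pi fun _ => halfLine).withDensity
      fun x => ENNReal.ofReal (densityConst m α * laguerreDet m α x) := by
  rw [unnormalized, volume_restrict_pi_Ioi]
  refine withDensity_congr_ae (ae_pi_halfLine fun x hx => ?_)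
  simp only [density_eq hα hx]

lemma measurable_ofReal_density :
    Measurable fun x => ENNReal.ofReal (densityConst m α * laguerreDet m α x) :=
  (measurable_laguerreDet.const_mul _).ennreal_ofReal

lemma integral_unnormalized (hα : 0 ≤ α) (u : (Fin m → ℝ) → ℝ) :
    ∫ x, u x ∂(unnormalized m α) =
      densityConst m α * ∫ x, u x * laguerreDet m α x ∂(Measure.pi fun _ => halfLine) := by
  rw [unnormalized_eq hα, integral_withDensity_eq_integral_toReal_smul measurable_ofReal_density
    (Filter.Eventually.of_forall fun _ => ENNReal.ofReal_lt_top), ← integral_const_mul]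
  refine integral_congr_ae (Filter.Eventually.of_forall fun x => ?_)
  simp only [smul_eq_mul]
  rw [ENNReal.toReal_ofReal (mul_nonneg (densityConst_pos hα).le (laguerreDet_nonneg hα x))]
  ring

lemma integrable_laguerreDet (hα : 0 ≤ α) :
    Integrable (laguerreDet m α) (Measure.pi fun _ => halfLine) := by
  have := (integral_prod_mul_detProduct (h := fun _ _ => (1 : ℝ))
    (φ := fun a : Fin m => phi α a) (ψ := fun a : Fin m => psi α a) (ν := halfLine)
    fun i a b => by simpa using integrable_psi_mul_phi hα a b).1
  simp only [Finset.prod_const_one, one_mul] at this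
  exact this

lemma integral_laguerreDet (hα : 0 ≤ α) :
    ∫ x, laguerreDet m α x ∂(Measure.pi fun _ => halfLine) = m.factorial := by
  -- With no formal variables the generating matrix is the constant Gram matrix, the identity, so
  -- the normalization is the `m!` of Andréief's identity.
  have h := integral_prod_sum_mul_detProduct (ι := Fin 0) (f := fun _ _ => (1 : ℝ))
    (φ := fun a : Fin m => phi α a) (ψ := fun a : Fin m => psi α a) (ν := halfLine)
    (fun i a b => by simpa using integrable_psi_mul_phi hα a b) ∅
  simp only [Finset.prod_empty, one_mul, Finset.prod_const_one] at h
  rw [laguerreDet, h, sqfreeCoeff_empty, RingHom.map_det]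
  have : (MvPowerSeries.constantCoeff.mapMatrix (Matrix.of fun a b : Fin m =>
      sqfreeSeries fun _ : Finset (Fin 0) => ∫ x, psi α a x * phi α b x ∂halfLine)) = 1 := by
    ext a b
    rw [RingHom.mapMatrix_apply, Matrix.map_apply, ← sqfreeCoeff_empty, Matrix.of_apply,
      sqfreeCoeff_sqfreeSeries, integral_psi_mul_phi hα, Matrix.one_apply]
    simp [Fin.ext_iff]
  rw [this, Matrix.det_one, mul_one]

lemma unnormalized_univ (hα : 0 ≤ α) :
    unnormalized m α univ = ENNReal.ofReal (densityConst m α * m.factorial) := by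
  rw [unnormalized_eq hα, withDensity_apply _ MeasurableSet.univ, Measure.restrict_univ,
    ← ofReal_integral_eq_lintegral_ofReal ((integrable_laguerreDet hα).const_mul _)
    (Filter.Eventually.of_forall fun x =>
      mul_nonneg (densityConst_pos hα).le (laguerreDet_nonneg hα x)),
    integral_const_mul, integral_laguerreDet hα]

lemma unnormalized_univ_ne_zero (hα : 0 ≤ α) : unnormalized m α univ ≠ 0 := by
  rw [unnormalized_univ hα]
  have := densityConst_pos (m := m) hα
  simp only [ne_eq, ENNReal.ofReal_eq_zero, not_le]
  positivity

lemma unnormalized_univ_ne_top (hα : 0 ≤ α) : unnormalized m α univ ≠ ⊤ := by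
  rw [unnormalized_univ hα]
  exact ENNReal.ofReal_ne_top

lemma integral_ensemble (hα : 0 ≤ α) (u : (Fin m → ℝ) → ℝ) :
    ∫ x, u x ∂(ensemble m α) = (m.factorial : ℝ)⁻¹ *
      ∫ x, u x * laguerreDet m α x ∂(Measure.pi fun _ => halfLine) := by
  have h := densityConst_pos (m := m) hα
  rw [ensemble, integral_smul_measure, integral_unnormalized hα, unnormalized_univ hα,
    ENNReal.toReal_inv, ENNReal.toReal_ofReal (by positivity), smul_eq_mul]
  have : (m.factorial : ℝ) ≠ 0 := by positivity
  field_simp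

/-- Moments of linear statistics as coefficients of a determinant. -/
theorem integral_prod_linearStat (hα : 0 ≤ α) {ι : Type*} [DecidableEq ι] {f : ι → ℝ → ℝ}
    (hf : ∀ (T : Finset ι) (a b : Fin m),
      Integrable (fun x => (∏ j ∈ T, f j x) * (psi α a x * phi α b x)) halfLine)
    (S : Finset ι) :
    ∫ x, ∏ j ∈ S, linearStat m (f j) x ∂(ensemble m α) =
      sqfreeCoeff S (Matrix.of fun a b : Fin m => sqfreeSeries fun T =>
        ∫ x, (∏ j ∈ T, f j x) * (psi α a x * phi α b x) ∂halfLine).det := by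
  rw [integral_ensemble hα]
  simp only [linearStat, laguerreDet]
  rw [integral_prod_sum_mul_detProduct hf]
  have : (m.factorial : ℝ) ≠ 0 := by positivity
  field_simp

/-- The marginal bound, tested on indicators, becomes an inequality of measures. In this form it
transfers integrability from the ensemble to the line for functions not yet known to be integrable
there. -/
lemma withDensity_le_map_unnormalized (hα : 0 ≤ α) (k a : Fin m) :
    halfLine.withDensity (fun x => ENNReal.ofReal (psi α a x * phi α a x)) ≤
      ENNReal.ofReal (densityConst m α)⁻¹ • (unnormalized m α).map (fun x => x k) := by
  have hC := densityConst_pos (m := m) hα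
  refine Measure.le_iff.2 fun A hA => ?_
  have hI : ∀ a b : Fin m, Integrable (fun x => A.indicator 1 x * (psi α a x * phi α b x))
      halfLine := by
    intro a b
    have := (integrable_psi_mul_phi hα a b).indicator hA
    refine this.congr (Filter.Eventually.of_forall fun x => ?_)
    by_cases hx : x ∈ A <;> simp [hx]
  obtain ⟨h1, h2⟩ := integral_mul_le_integral_eval (h := A.indicator 1)
    (φ := fun a : Fin m => phi α a) (ψ := fun a : Fin m => psi α a)
    (fun x => Set.indicator_nonneg (fun _ _ => zero_le_one) x) hI
    (fun a b => integrable_psi_mul_phi hα a b)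
    (fun a b => by rw [integral_psi_mul_phi hα]; simp [Fin.ext_iff])
    (fun a x => psi_mul_phi_nonneg hα a x) k a
  change Integrable (fun x : Fin m → ℝ => A.indicator 1 (x k) * laguerreDet m α x) _ at h1
  rw [withDensity_apply _ hA, Measure.smul_apply, Measure.map_apply (measurable_pi_apply k) hA,
    unnormalized_eq hα, withDensity_apply _ (measurable_pi_apply k hA), smul_eq_mul]
  have e1 : ∫⁻ x in A, ENNReal.ofReal (psi α a x * phi α a x) ∂halfLine =
      ENNReal.ofReal (∫ x, A.indicator 1 x * (psi α a x * phi α a x) ∂halfLine) := by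
    rw [ofReal_integral_eq_lintegral_ofReal (hI a a) (Filter.Eventually.of_forall fun x =>
      mul_nonneg (Set.indicator_nonneg (fun _ _ => zero_le_one) x) (psi_mul_phi_nonneg hα a x)),
      ← lintegral_indicator hA]
    refine lintegral_congr fun x => ?_
    by_cases hx : x ∈ A <;> simp [hx]
  have e2 : ENNReal.ofReal (∫ x : Fin m → ℝ, A.indicator 1 (x k) * laguerreDet m α x
      ∂(Measure.pi fun _ => halfLine)) = ENNReal.ofReal (densityConst m α)⁻¹ *
      ∫⁻ x in (fun x : Fin m → ℝ => x k) ⁻¹' A,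
        ENNReal.ofReal (densityConst m α * laguerreDet m α x)
        ∂(Measure.pi fun _ => halfLine) := by
    rw [ofReal_integral_eq_lintegral_ofReal h1 (Filter.Eventually.of_forall fun x =>
      mul_nonneg (Set.indicator_nonneg (fun _ _ => zero_le_one) _) (laguerreDet_nonneg hα x)),
      ← lintegral_const_mul _ measurable_ofReal_density,
      ← lintegral_indicator (measurable_pi_apply k hA)]
    refine lintegral_congr fun x => ?_
    have : (densityConst m α)⁻¹ * (densityConst m α * laguerreDet m α x) = laguerreDet m α x := by
      field_simp
    by_cases hx : x k ∈ A
    · simp only [Set.indicator_of_mem hx, Pi.one_apply, one_mul]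
      rw [Set.indicator_of_mem (show x ∈ (fun x : Fin m → ℝ => x k) ⁻¹' A from hx),
        ← ENNReal.ofReal_mul (inv_nonneg.2 hC.le), this]
    · rw [Set.indicator_of_notMem hx, Set.indicator_of_notMem
        (show x ∉ (fun x : Fin m → ℝ => x k) ⁻¹' A from hx)]
      simp
  rw [e1, ← e2]
  exact ENNReal.ofReal_le_ofReal h2

/-- Integrability of a one-point function under the ensemble, in terms of Laguerre functions. -/
theorem integrable_mul_psi_mul_phi_of_ensemble (hα : 0 ≤ α) {g : ℝ → ℝ}
    (hg : AEStronglyMeasurable g halfLine) (k : Fin m)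
    (h : Integrable (fun x => g (x k)) (ensemble m α)) (a b : Fin m) :
    Integrable (fun x => g x * (psi α a x * phi α b x)) halfLine := by
  have hu : Integrable (fun x : Fin m → ℝ => g (x k)) (unnormalized m α) := by
    rw [ensemble, integrable_smul_measure (ENNReal.inv_ne_zero.2 (unnormalized_univ_ne_top hα))
      (ENNReal.inv_ne_top.2 (unnormalized_univ_ne_zero hα))] at h
    exact h
  -- The eigenvalue measure is absolutely continuous with respect to the product measure, so a
  -- measurable version of `g` may be used.
  have hae : (fun x : Fin m → ℝ => g (x k)) =ᵐ[unnormalized m α] fun x => hg.mk g (x k) := by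
    rw [unnormalized_eq hα]
    refine (withDensity_absolutelyContinuous _ _).ae_le ?_
    exact (Measure.quasiMeasurePreserving_eval (fun _ : Fin m => halfLine) k).ae hg.ae_eq_mk
  have hm : Integrable (hg.mk g) ((unnormalized m α).map fun x => x k) := by
    rw [integrable_map_measure hg.stronglyMeasurable_mk.aestronglyMeasurable
      (measurable_pi_apply k).aemeasurable]
    exact hu.congr hae
  have hd : ∀ a : Fin m, Integrable (fun x => g x * (psi α a x * phi α a x)) halfLine := by
    intro a
    have h1 := (hm.smul_measure ENNReal.ofReal_ne_top).mono_measure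
      (withDensity_le_map_unnormalized hα k a)
    have hmeas : Measurable fun x => ENNReal.ofReal (psi α a x * phi α a x) :=
      ((measurable_psi α a).mul (measurable_phi α a)).ennreal_ofReal
    rw [integrable_withDensity_iff_integrable_smul' hmeas
      (Filter.Eventually.of_forall fun _ => ENNReal.ofReal_lt_top)] at h1
    refine h1.congr ?_
    filter_upwards [hg.ae_eq_mk] with x hx
    rw [ENNReal.toReal_ofReal (psi_mul_phi_nonneg hα a x), hx, smul_eq_mul, mul_comm]
  -- Off the diagonal use `|φ_a φ_b| ≤ φ_a² + φ_b²`; the inverse factors undo the normalization of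
  -- `psi`.
  have hb : Integrable (fun x => invNormSq α a * (|(invNormSq α a)⁻¹ *
      (g x * (psi α a x * phi α a x))| + |(invNormSq α b)⁻¹ * (g x * (psi α b x * phi α b x))|))
      halfLine :=
    (((hd a).const_mul _).abs.add ((hd b).const_mul _).abs).const_mul _
  refine Integrable.mono' hb (hg.mul ((measurable_psi α a).mul
    (measurable_phi α b)).aestronglyMeasurable) (Filter.Eventually.of_forall fun x => ?_)
  have ha0 := invNormSq_pos hα a
  have hb0 := invNormSq_pos hα b
  have e : ∀ c : Fin m, |(invNormSq α c)⁻¹ * (g x * (psi α c x * phi α c x))| =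
      |g x| * phi α c x ^ 2 := by
    intro c
    have := (invNormSq_pos hα c).ne'
    rw [show (invNormSq α c)⁻¹ * (g x * (psi α c x * phi α c x)) = g x * phi α c x ^ 2 by
      rw [psi]; field_simp, abs_mul, abs_of_nonneg (sq_nonneg (phi α c x))]
  rw [e, e, Real.norm_eq_abs, psi, show g x * (invNormSq α a * phi α a x * phi α b x) =
    invNormSq α a * (g x * (phi α a x * phi α b x)) by ring, abs_mul, abs_of_pos ha0, abs_mul]
  refine mul_le_mul_of_nonneg_left ?_ ha0.le
  rw [← mul_add]
  refine mul_le_mul_of_nonneg_left ?_ (abs_nonneg _)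
  rw [abs_le]
  constructor <;> nlinarith [sq_nonneg (phi α a x + phi α b x), sq_nonneg (phi α a x - phi α b x),
    sq_nonneg (phi α a x), sq_nonneg (phi α b x)]

end Ensemble

/-! ### Integrals over open chains of kernels as matrix products. -/

section Chain

variable {ν : Measure ℝ} [SigmaFinite ν]

lemma integrable_cons_iff {k : ℕ} (G : (Fin (k + 1) → ℝ) → ℝ) :
    Integrable (fun p : ℝ × (Fin k → ℝ) => G (Fin.cons p.1 p.2))
      (ν.prod (Measure.pi fun _ => ν)) ↔ Integrable G (Measure.pi fun _ => ν) := by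
  have h := (measurePreserving_piFinSuccAbove (fun _ : Fin (k + 1) => ν) 0).symm
  rw [← h.integrable_comp_emb (MeasurableEquiv.measurableEmbedding _)]
  refine integrable_congr (Filter.Eventually.of_forall fun p => ?_)
  simp [MeasurableEquiv.piFinSuccAbove_symm_apply, Fin.insertNthEquiv, Fin.insertNth_zero']

lemma integral_cons {k : ℕ} (G : (Fin (k + 1) → ℝ) → ℝ) :
    ∫ p : ℝ × (Fin k → ℝ), G (Fin.cons p.1 p.2) ∂(ν.prod (Measure.pi fun _ => ν)) =
      ∫ y, G y ∂(Measure.pi fun _ => ν) := by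
  have h := (measurePreserving_piFinSuccAbove (fun _ : Fin (k + 1) => ν) 0).symm
  rw [← h.integral_comp']
  refine integral_congr_ae (Filter.Eventually.of_forall fun p => ?_)
  simp [MeasurableEquiv.piFinSuccAbove_symm_apply, Fin.insertNthEquiv, Fin.insertNth_zero']

/-- The integrand of an open chain of kernels. -/
def chainIntegrand (K : ℝ → ℝ → ℝ) (k : ℕ) (u v : ℝ → ℝ) (F : Fin (k + 1) → ℝ → ℝ)
    (y : Fin (k + 1) → ℝ) : ℝ :=
  u (y 0) * v (y (Fin.last k)) * (∏ i, F i (y i)) * ∏ i : Fin k, K (y i.castSucc) (y i.succ)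

variable {m : ℕ} {φ ψ : ℕ → ℝ → ℝ} {ι : Type*} [DecidableEq ι]

/-- The matrices `∫ g_S ψ_a φ_b` for nonempty `S`. -/
def gramMatrix (ν : Measure ℝ) (m : ℕ) (φ ψ : ℕ → ℝ → ℝ) (g : Finset ι → ℝ → ℝ)
    (S : Finset ι) : Matrix (Fin (m + 1)) (Fin (m + 1)) ℝ :=
  -- The empty set is left out because `momentMatrix` adds the identity separately. The integral at
  -- `(m, m)` may diverge and then has the default value `0`; no final value depends on it.
  if S = ∅ then 0 else Matrix.of fun a b => ∫ x, g S x * (ψ a x * φ b x) ∂ν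

lemma mul_proj_mul_apply (N X : Matrix (Fin (m + 1)) (Fin (m + 1)) ℝ) (a b : Fin (m + 1)) :
    (N * proj m * X) a b = ∑ c : Fin m, N a c.castSucc * X c.castSucc b := by
  have h : N * proj m * X = (N * emb ℝ m) * ((emb ℝ m).transpose * X) := by
    rw [proj]; simp only [Matrix.mul_assoc]
  rw [h, Matrix.mul_apply]
  refine Finset.sum_congr rfl fun c _ => ?_
  congr 1 <;> simp [emb, Matrix.mul_apply]

/-- Chains of kernels integrate to products of Gram matrices. -/
theorem integral_chainIntegrand {K : ℝ → ℝ → ℝ}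
    (hK : ∀ x y, K x y = ∑ c : Fin m, φ c x * ψ c y) {g : Finset ι → ℝ → ℝ}
    (hg : ∀ S, ∀ a ≤ m, ∀ b ≤ m, (a < m ∨ b < m) →
      Integrable (fun x => g S x * (ψ a x * φ b x)) ν)
    (k : ℕ) (T : Fin (k + 1) → Finset ι) (hT : ∀ i, (T i).Nonempty) (a b : Fin (m + 1))
    (hab : (a : ℕ) < m ∨ (b : ℕ) < m) :
    Integrable (chainIntegrand K k (ψ a) (φ b) fun i => g (T i)) (Measure.pi fun _ => ν) ∧
    ∫ y, chainIntegrand K k (ψ a) (φ b) (fun i => g (T i)) y ∂(Measure.pi fun _ => ν) =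
      chainProd (fun S => gramMatrix ν m φ ψ g S * proj m) (gramMatrix ν m φ ψ g) k T a b := by
  induction k generalizing a with
  | zero =>
    have e : ∀ y : Fin 1 → ℝ, chainIntegrand K 0 (ψ a) (φ b) (fun i => g (T i)) y =
        ∏ i, (fun (i : Fin 1) x => g (T i) x * (ψ a x * φ b x)) i (y i) := by
      intro y
      simp [chainIntegrand]
      ring
    have hI := hg (T 0) a (by omega) b (by omega) hab
    constructor
    · rw [funext e]
      refine Integrable.fintype_prod
        (f := fun (i : Fin 1) x => g (T i) x * (ψ a x * φ b x)) fun i => ?_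
      rw [Subsingleton.elim i 0]
      exact hI
    · simp only [e]
      rw [integral_fintype_prod_eq_prod
        (f := fun (i : Fin 1) x => g (T i) x * (ψ a x * φ b x))]
      simp [chainProd, gramMatrix, (hT 0).ne_empty]
  | succ k ih =>
    -- Expanding the first kernel separates the first variable from the others. The new index `c` is
    -- below `m`, so the pair `(m, m)` never appears.
    have hI : ∀ c : Fin m, Integrable (fun x => g (T 0) x * (ψ a x * φ c x)) ν := fun c =>
      hg (T 0) a (by omega) c (by omega) (Or.inr c.2)
    have ih' := fun c : Fin m => ih (Fin.tail T) (fun i => hT i.succ) c.castSucc (Or.inl c.2)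
    have e : ∀ p : ℝ × (Fin (k + 1) → ℝ),
        chainIntegrand K (k + 1) (ψ a) (φ b) (fun i => g (T i)) (Fin.cons p.1 p.2) =
        ∑ c : Fin m, (g (T 0) p.1 * (ψ a p.1 * φ c p.1)) *
          chainIntegrand K k (ψ c.castSucc) (φ b) (fun i => g (Fin.tail T i)) p.2 := by
      rintro ⟨x, z⟩
      have eF : ∏ i, g (T i) ((Fin.cons x z : Fin (k + 2) → ℝ) i) =
          g (T 0) x * ∏ i, g (Fin.tail T i) (z i) := Fin.prod_univ_succ _
      have eK : ∏ i : Fin (k + 1), K ((Fin.cons x z : Fin (k + 2) → ℝ) i.castSucc)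
          ((Fin.cons x z : Fin (k + 2) → ℝ) i.succ) =
          K x (z 0) * ∏ i : Fin k, K (z i.castSucc) (z i.succ) := Fin.prod_univ_succ _
      simp only [chainIntegrand]
      rw [eF, eK]
      simp only [Fin.cons_zero, ← Fin.succ_last, Fin.cons_succ]
      rw [hK, Finset.sum_mul, Finset.mul_sum]
      refine Finset.sum_congr rfl fun c _ => ?_
      simp only [Fin.tail, Fin.val_castSucc]
      ring
    have hprod := fun c : Fin m => (hI c).mul_prod (ih' c).1
    constructor
    · rw [← integrable_cons_iff, funext e]
      exact integrable_finsetSum _ fun c _ => hprod c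
    · rw [← integral_cons]
      simp only [e]
      rw [integral_finsetSum _ fun c _ => hprod c, chainProd, mul_proj_mul_apply]
      refine Finset.sum_congr rfl fun c _ => ?_
      rw [integral_prod_mul (fun x => g (T 0) x * (ψ a x * φ c x)), (ih' c).2]
      congr 1
      simp [gramMatrix, (hT 0).ne_empty]

end Chain

/-! ### The kernels as matrices, and the decoupled integrals as traces. -/

section Kernels

variable {m : ℕ} {α : ℝ}

/-- The matrix of the operator `2 x d/dx + 1` in the Laguerre functions. -/
def eulerMatrix (m : ℕ) (α : ℝ) : Matrix (Fin (m + 1)) (Fin (m + 1)) ℝ :=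
  Matrix.of fun a b =>
    if (b : ℕ) = a + 1 then (a : ℝ) + 1 + α else if (a : ℕ) = b + 1 then -(a : ℝ) else 0

/-- The coefficients of `kernelD` in the Laguerre functions. -/
def boundaryMatrix (m : ℕ) (α : ℝ) : Matrix (Fin (m + 1)) (Fin (m + 1)) ℝ :=
  (1 / 2 : ℝ) • (eulerMatrix m α * proj m - proj m * eulerMatrix m α)

lemma proj_eq_diagonal (m : ℕ) :
    proj m = Matrix.diagonal fun a : Fin (m + 1) => if (a : ℕ) < m then 1 else 0 := by
  ext a b
  rw [proj, Matrix.mul_apply, Matrix.diagonal_apply]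
  simp only [emb, Matrix.of_apply, Matrix.transpose_apply]
  by_cases ha : (a : ℕ) < m
  · obtain ⟨c, rfl⟩ : ∃ c : Fin m, a = c.castSucc := ⟨⟨a, ha⟩, rfl⟩
    rw [Finset.sum_eq_single c]
    · simp [eq_comm]
    · intro d _ hd
      rw [if_neg (fun h => hd (Fin.castSucc_injective _ h).symm), zero_mul]
    · simp
  · have : ∀ c : Fin m, a ≠ c.castSucc := fun c h => ha (by rw [h]; exact c.2)
    simp [this, ha]

/-- Commuting with a diagonal projection keeps only entries whose indices are separated by the cut
at `m`. As `eulerMatrix` is tridiagonal, just `(m-1, m)` and `(m, m-1)` survive. -/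
lemma boundaryMatrix_apply (a b : Fin (m + 1)) : boundaryMatrix m α a b =
    (1 / 2 : ℝ) * (eulerMatrix m α a b *
      ((if (b : ℕ) < m then 1 else 0) - if (a : ℕ) < m then 1 else 0)) := by
  rw [boundaryMatrix, proj_eq_diagonal, Matrix.smul_apply, Matrix.sub_apply,
    Matrix.mul_diagonal, Matrix.diagonal_mul, smul_eq_mul]
  ring

lemma sum_boundaryMatrix (hm : 1 ≤ m) (Z : Fin (m + 1) → Fin (m + 1) → ℝ) :
    ∑ a, ∑ b, boundaryMatrix m α a b * Z a b =
      -(1 / 2) * (m + α) * Z ⟨m - 1, by omega⟩ (Fin.last m) -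
        (1 / 2) * m * Z (Fin.last m) ⟨m - 1, by omega⟩ := by
  obtain ⟨n, rfl⟩ : ∃ n, m = n + 1 := ⟨m - 1, by omega⟩
  have e0 : (⟨n + 1 - 1, by omega⟩ : Fin (n + 1 + 1)) = (Fin.last n).castSucc := rfl
  simp only [e0]
  rw [Fin.sum_univ_castSucc]
  simp only [Fin.sum_univ_castSucc (n := n + 1)]
  have h1 : ∀ a b : Fin (n + 1), boundaryMatrix (n + 1) α a.castSucc b.castSucc = 0 := by
    intro a b
    rw [boundaryMatrix_apply, if_pos (show (b.castSucc : ℕ) < n + 1 from b.2),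
      if_pos (show (a.castSucc : ℕ) < n + 1 from a.2), sub_self, mul_zero, mul_zero]
  have h2 : boundaryMatrix (n + 1) α (Fin.last (n + 1)) (Fin.last (n + 1)) = 0 := by
    rw [boundaryMatrix_apply]; simp
  have h3 : ∀ a : Fin (n + 1), boundaryMatrix (n + 1) α a.castSucc (Fin.last (n + 1)) =
      if a = Fin.last n then -(1 / 2) * (n + 1 + α) else 0 := by
    intro a
    rw [boundaryMatrix_apply, eulerMatrix]
    simp only [Matrix.of_apply, Fin.val_castSucc, Fin.val_last, a.2, if_true, lt_irrefl, if_false]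
    by_cases h : a = Fin.last n
    · subst h
      simp
      ring
    · have : (a : ℕ) ≠ n := fun h' => h (Fin.ext h')
      rw [if_neg (by omega), if_neg (by omega), if_neg h]
      ring
  have h4 : ∀ a : Fin (n + 1), boundaryMatrix (n + 1) α (Fin.last (n + 1)) a.castSucc =
      if a = Fin.last n then -(1 / 2) * ((n : ℝ) + 1) else 0 := by
    intro a
    rw [boundaryMatrix_apply, eulerMatrix]
    simp only [Matrix.of_apply, Fin.val_castSucc, Fin.val_last, a.2, if_true, lt_irrefl, if_false]
    by_cases h : a = Fin.last n
    · subst h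
      rw [Fin.val_last, if_neg (by omega), if_pos rfl, if_pos rfl]
      push_cast
      ring
    · have : (a : ℕ) ≠ n := fun h' => h (Fin.ext h')
      rw [if_neg (by omega), if_neg (by omega), if_neg h]
      ring
  simp only [h1, h2, h3, h4, zero_mul, Finset.sum_const_zero, ite_mul, Finset.sum_ite_eq',
    Finset.mem_univ, if_true, zero_add, add_zero]
  push_cast
  ring

lemma kernel_eq {x y : ℝ} (hx : 0 < x) :
    kernel m α x y = ∑ c : Fin m, phi α c x * psi α c y := by
  rw [kernel, Real.sqrt_mul (weight_nonneg hx.le), Finset.sum_range, Finset.mul_sum]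
  refine Finset.sum_congr rfl fun c _ => ?_
  rw [psi, phi, phi, invNormSq]
  ring

/-- The surviving entries `-(m+α)/2` and `-m/2` become equal once the norms in `psi` are included:
`(m+α) invNormSq m = m invNormSq (m-1) = m!/Γ(m+α)`. Hence the symmetry of `L_D`. -/
lemma kernelD_eq (hm : 1 ≤ m) (hα : 0 ≤ α) {x y : ℝ} (hx : 0 < x) :
    kernelD m α x y = ∑ a : Fin (m + 1), ∑ b : Fin (m + 1),
      boundaryMatrix m α a b * (phi α a x * psi α b y) := by
  rw [sum_boundaryMatrix hm, kernelD, Real.sqrt_mul (weight_nonneg hx.le)]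
  obtain ⟨n, rfl⟩ : ∃ n, m = n + 1 := ⟨m - 1, by omega⟩
  simp only [Nat.add_sub_cancel, Fin.val_last, psi, phi, invNormSq]
  have h1 := gamma_succ hα n
  have h2 := (gamma_pos hα n).ne'
  have h3 : ((n + 1 : ℕ) : ℝ) + α = n + α + 1 := by push_cast; ring
  have h4 : (n : ℝ) + α + 1 ≠ 0 := by positivity
  rw [h1, h3, Nat.factorial_succ]
  push_cast
  field_simp
  ring

/-- The kernel of the ensemble as a finite rank expression without positivity assumption. -/
def kernelSum (m : ℕ) (α x y : ℝ) : ℝ := ∑ c : Fin m, phi α c x * psi α c y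

/-- The factor `L_D` joins the last variable to the first. Its finite rank expansion cuts the cycle
there, leaving `psi b` at the start and `phi a` at the end of an open chain. -/
lemma decoupledIntegrand_cycleOf (hm : 1 ≤ m) (hα : 0 ≤ α) {l k : ℕ} (f : Fin l → ℝ → ℝ)
    (π : Finpartition (Finset.univ : Finset (Fin l))) (e : Fin (k + 1) ≃ π.parts)
    {x : π.parts → ℝ} (hx : ∀ p, 0 < x p) :
    decoupledIntegrand (kernel m α) (kernelD m α) f π (cycleOf e) (e (Fin.last k)) x =
      ∑ a : Fin (m + 1), ∑ b : Fin (m + 1), boundaryMatrix m α a b *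
        chainIntegrand (kernelSum m α) k (psi α b) (phi α a)
          (fun i y => ∏ s ∈ (e i).1, f s y) fun i => x (e i) := by
  have h1 : ∏ p : π.parts, ∏ s ∈ p.1, f s (x p) =
      ∏ i, ∏ s ∈ (e i).1, f s (x (e i)) :=
    (Equiv.prod_comp e fun p : π.parts => ∏ s ∈ p.1, f s (x p)).symm
  have h2 : ∏ p ∈ Finset.univ.erase (e (Fin.last k)), kernel m α (x p) (x (cycleOf e p)) =
      ∏ i : Fin k, kernelSum m α (x (e i.castSucc)) (x (e i.succ)) := by
    symm
    refine Finset.prod_bij (fun i _ => e i.castSucc) ?_ ?_ ?_ ?_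
    · intro i _
      rw [Finset.mem_erase]
      exact ⟨fun h => (Fin.castSucc_lt_last i).ne (e.injective h), Finset.mem_univ _⟩
    · intro i _ j _ h
      exact Fin.castSucc_injective _ (e.injective h)
    · intro p hp
      rw [Finset.mem_erase] at hp
      have hne : e.symm p ≠ Fin.last k := by
        intro h
        apply hp.1
        rw [← h, Equiv.apply_symm_apply]
      exact ⟨(e.symm p).castPred hne, Finset.mem_univ _, by simp⟩
    · intro i _
      rw [cycleOf_apply, Fin.coeSucc_eq_succ, kernel_eq (hx _)]
      rfl
  rw [decoupledIntegrand, h1, h2, cycleOf_apply, Fin.last_add_one, kernelD_eq hm hα (hx _),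
    Finset.sum_mul, Finset.sum_mul]
  refine Finset.sum_congr rfl fun a _ => ?_
  rw [Finset.sum_mul, Finset.sum_mul]
  refine Finset.sum_congr rfl fun b _ => ?_
  rw [chainIntegrand]
  ring

/-- Convergence and value of the decoupled integrals. -/
theorem integral_decoupledIntegrand (hm : 1 ≤ m) (hα : 0 ≤ α) {l k : ℕ} {f : Fin l → ℝ → ℝ}
    (hf : ∀ S : Finset (Fin l), ∀ a ≤ m, ∀ b ≤ m, (a < m ∨ b < m) →
      Integrable (fun x => (∏ s ∈ S, f s x) * (psi α a x * phi α b x)) halfLine)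
    (π : Finpartition (Finset.univ : Finset (Fin l))) (e : Fin (k + 1) ≃ π.parts) :
    IntegrableOn (decoupledIntegrand (kernel m α) (kernelD m α) f π (cycleOf e) (e (Fin.last k)))
      (univ.pi fun _ => Ioi 0) ∧
    ∫ x in univ.pi fun _ => Ioi 0, decoupledIntegrand (kernel m α) (kernelD m α) f π
        (cycleOf e) (e (Fin.last k)) x =
      (boundaryMatrix m α * chainProd
        (fun S => gramMatrix halfLine m (phi α) (psi α) (fun S x => ∏ s ∈ S, f s x) S * proj m)
        (gramMatrix halfLine m (phi α) (psi α) fun S x => ∏ s ∈ S, f s x) k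
        fun i => (e i).1).trace := by
  have hmp := measurePreserving_piCongrLeft (fun _ : π.parts => halfLine) e
  have hpt : ∀ (y : Fin (k + 1) → ℝ) i,
      MeasurableEquiv.piCongrLeft (fun _ : π.parts => ℝ) e y (e i) = y i := by
    intro y i
    rw [MeasurableEquiv.coe_piCongrLeft]
    exact Equiv.piCongrLeft_apply_apply (P := fun _ : π.parts => ℝ) e y i
  have hae : (decoupledIntegrand (kernel m α) (kernelD m α) f π (cycleOf e) (e (Fin.last k)) ∘
      MeasurableEquiv.piCongrLeft (fun _ : π.parts => ℝ) e) =ᵐ[Measure.pi fun _ => halfLine]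
      fun y => ∑ a : Fin (m + 1), ∑ b : Fin (m + 1), boundaryMatrix m α a b *
        chainIntegrand (kernelSum m α) k (psi α b) (phi α a)
          (fun i y => ∏ s ∈ (e i).1, f s y) y := by
    refine ae_pi_halfLine fun y hy => ?_
    rw [Function.comp_apply, decoupledIntegrand_cycleOf hm hα f π e]
    · simp only [hpt]
    · intro p
      obtain ⟨i, rfl⟩ := e.surjective p
      rw [hpt]
      exact hy i
  have hchain := fun (a b : Fin (m + 1)) (hab : (b : ℕ) < m ∨ (a : ℕ) < m) =>
    integral_chainIntegrand (ν := halfLine) (φ := phi α) (ψ := psi α) (K := kernelSum m α)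
      (fun x y => rfl) (g := fun S x => ∏ s ∈ S, f s x) hf k (fun i => (e i).1)
      (fun i => π.nonempty_of_mem_parts (e i).2) b a hab
  have hterm : ∀ a b : Fin (m + 1), Integrable (fun y => boundaryMatrix m α a b *
      chainIntegrand (kernelSum m α) k (psi α b) (phi α a)
        (fun i y => ∏ s ∈ (e i).1, f s y) y) (Measure.pi fun _ => halfLine) ∧
      ∫ y, boundaryMatrix m α a b * chainIntegrand (kernelSum m α) k (psi α b) (phi α a)
        (fun i y => ∏ s ∈ (e i).1, f s y) y ∂(Measure.pi fun _ => halfLine) =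
      boundaryMatrix m α a b * chainProd
        (fun S => gramMatrix halfLine m (phi α) (psi α) (fun S x => ∏ s ∈ S, f s x) S * proj m)
        (gramMatrix halfLine m (phi α) (psi α) fun S x => ∏ s ∈ S, f s x) k
        (fun i => (e i).1) b a := by
    intro a b
    by_cases hab : (b : ℕ) < m ∨ (a : ℕ) < m
    · refine ⟨(hchain a b hab).1.const_mul _, ?_⟩
      rw [integral_const_mul, (hchain a b hab).2]
    -- The possibly divergent pair `(m, m)` carries coefficient zero.
    · have : boundaryMatrix m α a b = 0 := by
        push Not at hab
        rw [boundaryMatrix_apply, if_neg (by omega), if_neg (by omega)]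
        simp
      simp [this]
  have hint : Integrable (fun y => ∑ a : Fin (m + 1), ∑ b : Fin (m + 1),
      boundaryMatrix m α a b * chainIntegrand (kernelSum m α) k (psi α b) (phi α a)
        (fun i y => ∏ s ∈ (e i).1, f s y) y) (Measure.pi fun _ => halfLine) :=
    integrable_finsetSum _ fun a _ => integrable_finsetSum _ fun b _ => (hterm a b).1
  rw [IntegrableOn, volume_restrict_pi_Ioi]
  constructor
  · rw [← hmp.integrable_comp_emb (MeasurableEquiv.measurableEmbedding _)]
    exact hint.congr hae.symm
  · rw [← hmp.integral_comp']
    refine (integral_congr_ae hae).trans ?_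
    rw [integral_finsetSum _ fun a _ => integrable_finsetSum _ fun b _ => (hterm a b).1]
    rw [Matrix.trace]
    refine Finset.sum_congr rfl fun a _ => ?_
    rw [integral_finsetSum _ fun b _ => (hterm a b).1, Matrix.diag_apply, Matrix.mul_apply]
    exact Finset.sum_congr rfl fun b _ => (hterm a b).2

end Kernels

/-! ### Integration by parts as a matrix commutator. -/

section EulerCommutator

variable {m : ℕ} {α : ℝ}

/-- For `b < m` the upper neighbour `b + 1` is still an index; this is why the matrices have size `m
+ 1`. -/
lemma sum_mul_eulerMatrix (b : Fin m) (z : ℕ → ℝ) :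
    ∑ c : Fin (m + 1), z c * eulerMatrix m α c b.castSucc =
      (if (b : ℕ) = 0 then 0 else (b + α) * z (b - 1)) - (b + 1) * z (b + 1) := by
  let F : ℕ → ℝ := fun c => (if (b : ℕ) = c + 1 then z c * (c + 1 + α) else 0) -
    if c = (b : ℕ) + 1 then z c * c else 0
  have e : ∀ c : Fin (m + 1), z c * eulerMatrix m α c b.castSucc = F c := by
    intro c
    simp only [F, eulerMatrix, Matrix.of_apply, Fin.val_castSucc]
    split_ifs <;> first | omega | ring
  rw [Finset.sum_congr rfl fun c _ => e c, Fin.sum_univ_eq_sum_range F, Finset.sum_sub_distrib,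
    Finset.sum_ite_eq', if_pos (Finset.mem_range.2 (by omega))]
  obtain ⟨b, hb⟩ := b
  rcases b with _ | b
  · simp
  · simp only [Nat.add_right_cancel_iff, Nat.succ_ne_zero, if_false, Nat.add_sub_cancel]
    rw [Finset.sum_ite_eq, if_pos (Finset.mem_range.2 (by omega))]
    push_cast
    ring

lemma sum_eulerMatrix_mul (a : Fin m) (z : ℕ → ℝ) :
    ∑ c : Fin (m + 1), eulerMatrix m α a.castSucc c * z c =
      (a + 1 + α) * z (a + 1) - if (a : ℕ) = 0 then 0 else a * z (a - 1) := by
  let F : ℕ → ℝ := fun c => (if c = (a : ℕ) + 1 then (a + 1 + α) * z c else 0) -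
    if (a : ℕ) = c + 1 then a * z c else 0
  have e : ∀ c : Fin (m + 1), eulerMatrix m α a.castSucc c * z c = F c := by
    intro c
    simp only [F, eulerMatrix, Matrix.of_apply, Fin.val_castSucc]
    split_ifs <;> first | omega | ring
  rw [Finset.sum_congr rfl fun c _ => e c, Fin.sum_univ_eq_sum_range F, Finset.sum_sub_distrib,
    Finset.sum_ite_eq', if_pos (Finset.mem_range.2 (by omega))]
  obtain ⟨a, ha⟩ := a
  rcases a with _ | a
  · simp
  · simp only [Nat.add_right_cancel_iff, Nat.succ_ne_zero, if_false, Nat.add_sub_cancel]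
    rw [Finset.sum_ite_eq, if_pos (Finset.mem_range.2 (by omega))]

/-- Converts the coefficients of `laguerreShift`, which act on `phi`, into those acting on `psi`, as
the left factor of the commutator requires. -/
lemma invNormSq_succ (hα : 0 ≤ α) (a : ℕ) :
    (a + 1 + α) * invNormSq α (a + 1) = (a + 1) * invNormSq α a := by
  have h1 := gamma_succ hα a
  have h2 := (gamma_pos hα a).ne'
  have h4 : (a : ℝ) + α + 1 ≠ 0 := by positivity
  rw [invNormSq, invNormSq, h1, Nat.factorial_succ]
  push_cast
  field_simp
  ring

variable {g g' : ℝ → ℝ}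

/-- Integration by parts as a commutator with `eulerMatrix`. -/
theorem integral_euler_mul_psi_mul_phi (hm : 1 ≤ m) (hα : 0 ≤ α)
    (hg : ∀ x, 0 < x → HasDerivAt g (g' x) x)
    (h0 : ∀ a b : Fin m, Integrable (fun x => g x * (psi α a x * phi α b x)) halfLine)
    (h1 : ∀ a b : Fin m, Integrable (fun x => (x * g' x) * (psi α a x * phi α b x)) halfLine) :
    (∀ a ≤ m, ∀ b ≤ m, (a < m ∨ b < m) →
      Integrable (fun x => g x * (psi α a x * phi α b x)) halfLine) ∧
    ∀ (N : Matrix (Fin (m + 1)) (Fin (m + 1)) ℝ),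
      (∀ a b, N a b = ∫ x, g x * (psi α a x * phi α b x) ∂halfLine) → ∀ a b : Fin m,
      ∫ x, (x * g' x) * (psi α a x * phi α b x) ∂halfLine =
        (1 / 2 : ℝ) * (N * eulerMatrix m α - eulerMatrix m α * N) a.castSucc b.castSucc := by
  -- The hypotheses reach total degree `2(m-1)`; the gain of one in `k2` covers every pair up to `m`
  -- other than `(m, m)`.
  have k0 : ∀ a ≤ m - 1, ∀ b ≤ m - 1, IntegrableOn
      (fun x => laguerre α a x * (laguerre α b x * (g x * weight α x))) (Ioi 0) :=
    fun a ha b hb => (integrable_mul_psi_mul_phi_iff hα g a b).1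
      (h0 ⟨a, by omega⟩ ⟨b, by omega⟩)
  have k1 : ∀ a ≤ m - 1, ∀ b ≤ m - 1, IntegrableOn
      (fun x => laguerre α a x * (laguerre α b x * (x * g' x * weight α x))) (Ioi 0) :=
    fun a ha b hb => (integrable_mul_psi_mul_phi_iff hα (fun x => x * g' x) a b).1
      (h1 ⟨a, by omega⟩ ⟨b, by omega⟩)
  have k2 := fun {a b : ℕ} (hab : a + b ≤ 2 * (m - 1) + 1) =>
    integrableOn_laguerre_mul_laguerre hα hg k0 k1 hab
  refine ⟨fun a ha b hb hab => (integrable_mul_psi_mul_phi_iff hα g a b).2 (k2 (by omega)), ?_⟩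
  intro N hN a b
  set J : ℕ → ℕ → ℝ := fun a b =>
    ∫ x in Ioi 0, laguerre α a x * (laguerre α b x * (g x * weight α x)) with hJ
  have hJs : ∀ a b, J a b = J b a := by
    intro a b
    simp only [hJ]
    congr 1
    funext x
    ring
  have hNJ : ∀ a b : Fin (m + 1), N a b = invNormSq α a * J a b := by
    intro a b
    rw [hN, integral_mul_psi_mul_phi]
  have hshift : ∀ a b : Fin m,
      ∫ x in Ioi 0, laguerreShift α a x * (laguerre α b x * (g x * weight α x)) =
        (a + 1) * J (a + 1) b - if (a : ℕ) = 0 then 0 else (a + α) * J (a - 1) b := by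
    intro a b
    have e : ∀ x, laguerreShift α a x * (laguerre α b x * (g x * weight α x)) =
        (a + 1) * (laguerre α (a + 1) x * (laguerre α b x * (g x * weight α x))) -
        (if (a : ℕ) = 0 then 0 else (a + α)) *
          (laguerre α (a - 1) x * (laguerre α b x * (g x * weight α x))) := by
      intro x
      rw [laguerreShift]
      split_ifs <;> ring
    simp only [e]
    rw [integral_sub ((k2 (by omega)).const_mul _) ((k2 (by omega)).const_mul _),
      integral_const_mul, integral_const_mul]
    split_ifs <;> simp [hJ]
  rw [integral_mul_psi_mul_phi (fun x => x * g' x),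
    integral_euler_mul_laguerre hα hg k0 k1 (by omega) (by omega), hshift, hshift,
    Matrix.sub_apply, Matrix.mul_apply, Matrix.mul_apply]
  simp only [hNJ]
  have e1 := sum_mul_eulerMatrix (α := α) b fun c => invNormSq α a * J a c
  have e2 := sum_eulerMatrix_mul (α := α) a fun c => invNormSq α c * J c b
  simp only [Fin.val_castSucc]
  rw [e1, e2, hJs (b + 1) a, hJs (b - 1) a]
  have e3 := invNormSq_succ hα a
  have e4 : (if (a : ℕ) = 0 then 0 else (a : ℝ) * (invNormSq α (a - 1) * J (a - 1) b)) =
      invNormSq α a * if (a : ℕ) = 0 then 0 else (a + α) * J (a - 1) b := by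
    split_ifs with h
    · simp
    · obtain ⟨c, hc⟩ : ∃ c, (a : ℕ) = c + 1 := ⟨a - 1, by omega⟩
      rw [hc, Nat.add_sub_cancel]
      have := invNormSq_succ hα c
      push_cast
      linear_combination -(J c b) * this
  have e5 : (if (b : ℕ) = 0 then 0 else ((b : ℝ) + α) * (invNormSq α a * J a (b - 1))) =
      invNormSq α a * if (b : ℕ) = 0 then 0 else (b + α) * J a (b - 1) := by
    split_ifs <;> ring
  rw [e4, e5]
  linear_combination (1 / 2 * J (a + 1) b) * e3

end EulerCommutator

/-! ### The product rule for cumulants and the identification of the moment matrix. -/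

section CumulantDerivative

variable {l : ℕ}

/-- The product rule for the terms of a joint cumulant. -/
lemma sum_prod_parts {M : Finset (Fin l) → ℝ} {Mj : Fin l → Finset (Fin l) → ℝ}
    (h : ∀ j T, j ∉ T → Mj j T = M T)
    (π : Finpartition (Finset.univ : Finset (Fin l))) :
    ∑ j, ∏ B ∈ π.parts, Mj j B =
      ∑ B ∈ π.parts, (∑ j ∈ B, Mj j B) * ∏ C ∈ π.parts.erase B, M C := by
  have h1 : ∀ B ∈ π.parts, ∀ j ∈ B, ∏ C ∈ π.parts, Mj j C =
      Mj j B * ∏ C ∈ π.parts.erase B, M C := by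
    intro B hB j hj
    rw [← Finset.mul_prod_erase _ _ hB]
    congr 1
    refine Finset.prod_congr rfl fun C hC => h j C fun hjC => ?_
    rw [Finset.mem_erase] at hC
    exact hC.1 (π.eq_of_mem_parts hC.2 hB hjC hj)
  calc ∑ j, ∏ B ∈ π.parts, Mj j B
      = ∑ B ∈ π.parts, ∑ j ∈ B, ∏ C ∈ π.parts, Mj j C := by
        have := Finset.sum_biUnion (s := π.parts) (t := id) (f := fun j => ∏ C ∈ π.parts, Mj j C)
          π.disjoint
        rwa [π.biUnion_parts] at this
    _ = _ := by
        refine Finset.sum_congr rfl fun B hB => ?_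
        rw [Finset.sum_mul]
        exact Finset.sum_congr rfl fun j hj => h1 B hB j hj

lemma prod_update_of_notMem {f : Fin l → ℝ → ℝ} {j : Fin l} (u : ℝ → ℝ)
    {T : Finset (Fin l)} (hj : j ∉ T) (x : ℝ) :
    ∏ s ∈ T, Function.update f j u s x = ∏ s ∈ T, f s x := by
  refine Finset.prod_congr rfl fun s hs => ?_
  rw [Function.update_of_ne (fun h : s = j => hj (h ▸ hs))]

lemma prod_update_of_mem {f : Fin l → ℝ → ℝ} {j : Fin l} (u : ℝ → ℝ)
    {T : Finset (Fin l)} (hj : j ∈ T) (x : ℝ) :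
    ∏ s ∈ T, Function.update f j u s x = u x * ∏ s ∈ T.erase j, f s x := by
  rw [← Finset.mul_prod_erase _ _ hj, Function.update_self,
    prod_update_of_notMem u (Finset.notMem_erase j T)]

end CumulantDerivative

/-- Orthonormality makes the identity summand of `momentMatrix` the coefficient at the empty set,
which `gramMatrix` omits. -/
lemma momentMatrix_eq {m : ℕ} {α : ℝ} (hα : 0 ≤ α) {l : ℕ} (f : Fin l → ℝ → ℝ) :
    momentMatrix (gramMatrix halfLine m (phi α) (psi α) fun (S : Finset (Fin l)) x =>
      ∏ s ∈ S, f s x) = Matrix.of fun a b : Fin m => sqfreeSeries fun T =>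
        ∫ x, (∏ j ∈ T, f j x) * (psi α a x * phi α b x) ∂halfLine := by
  ext a b d
  rw [Matrix.of_apply, coeff_sqfreeSeries]
  split_ifs with hd
  · conv_lhs => rw [hd]
    change sqfreeCoeff d.support _ = _
    rw [sqfreeCoeff_momentMatrix, gramMatrix]
    split_ifs with h
    · rw [h]
      simp only [Finset.prod_empty, one_mul, integral_psi_mul_phi hα]
      simp [Matrix.one_apply, Fin.ext_iff]
    · simp
  · rw [momentMatrix, emb_conj, Matrix.add_apply, map_add, Matrix.submatrix_apply, genMatrix,
      Matrix.of_apply, coeff_sqfreeSeries, if_neg hd, add_zero, Matrix.one_apply]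
    have : d ≠ 0 := by
      rintro rfl
      apply hd
      rw [Finsupp.support_zero, sqfreeExp_empty]
    split_ifs
    · rw [MvPowerSeries.coeff_one, if_neg this]
    · simp

end WishartLaguerre

end

/-! ### Assembly of the theorem. -/

open WishartLaguerre in
theorem proposition3 (m l : ℕ) (hm : 1 ≤ m) (hl : 1 ≤ l) (α : ℝ) (hα : 0 ≤ α)
    (f : Fin l → ℝ → ℝ)
    (hf : ∀ j, DifferentiableOn ℝ (f j) (Set.Ioi 0))
    (hmom : ∀ (S : Finset (Fin l)) (i : Fin m),
      MeasureTheory.Integrable (fun x => ∏ s ∈ S, f s (x i)) (WishartLaguerre.ensemble m α))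
    (hmom' : ∀ (S : Finset (Fin l)) (r : Fin l), r ∉ S → ∀ i : Fin m,
      MeasureTheory.Integrable
        (fun x => WishartLaguerre.eulerDeriv (f r) (x i) * ∏ s ∈ S, f s (x i))
        (WishartLaguerre.ensemble m α)) :
    (∀ (π : Finpartition (Finset.univ : Finset (Fin l))) (σ : Equiv.Perm π.parts),
      σ.IsCycleOn Set.univ → ∀ v : π.parts,
        MeasureTheory.IntegrableOn
          (WishartLaguerre.decoupledIntegrand (WishartLaguerre.kernel m α)
            (WishartLaguerre.kernelD m α) f π σ v)
          (Set.univ.pi fun _ : π.parts => Set.Ioi (0 : ℝ))) ∧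
    WishartLaguerre.decoupledIntegral (WishartLaguerre.kernel m α)
        (WishartLaguerre.kernelD m α) f =
      WishartLaguerre.cumulantDeriv m α f := by
  have : Nonempty (Fin l) := ⟨⟨0, hl⟩⟩
  let i₀ : Fin m := ⟨0, hm⟩
  have hfm : ∀ S : Finset (Fin l), AEStronglyMeasurable (fun x => ∏ s ∈ S, f s x) halfLine :=
    fun S => (continuousOn_finsetProd S fun s _ => (hf s).continuousOn).aestronglyMeasurable
      measurableSet_Ioi
  have hem : ∀ r, Measurable (eulerDeriv (f r)) := fun r =>
    measurable_id.mul (measurable_deriv (f r))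
  -- one-dimensional integrability
  have hI : ∀ (S : Finset (Fin l)) (a b : Fin m),
      Integrable (fun x => (∏ s ∈ S, f s x) * (psi α a x * phi α b x)) halfLine := fun S a b =>
    integrable_mul_psi_mul_phi_of_ensemble hα (hfm S) i₀ (hmom S i₀) a b
  have hIj : ∀ (j : Fin l) (S : Finset (Fin l)) (a b : Fin m),
      Integrable (fun x => (∏ s ∈ S, Function.update f j (eulerDeriv (f j)) s x) *
        (psi α a x * phi α b x)) halfLine := by
    intro j S a b
    by_cases hj : j ∈ S
    · simp only [prod_update_of_mem _ hj]
      exact integrable_mul_psi_mul_phi_of_ensemble hα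
        ((hem j).aestronglyMeasurable.mul (hfm (S.erase j))) i₀
        (hmom' (S.erase j) j (Finset.notMem_erase j S) i₀) a b
    · simp only [prod_update_of_notMem _ hj]
      exact hI S a b
  -- the derivative of the products
  let g' : Finset (Fin l) → ℝ → ℝ := fun S x =>
    ∑ j ∈ S, (∏ s ∈ S.erase j, f s x) * deriv (f j) x
  have hg : ∀ (S : Finset (Fin l)) (x : ℝ), 0 < x →
      HasDerivAt (fun x => ∏ s ∈ S, f s x) (g' S x) x := by
    intro S x hx
    have := HasDerivAt.fun_finsetProd (u := S) (f := f) (f' := fun j => deriv (f j) x) (x := x)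
      fun j _ => ((hf j).differentiableAt (Ioi_mem_nhds hx)).hasDerivAt
    simpa only [smul_eq_mul] using this
  have hg' : ∀ (S : Finset (Fin l)) (a b : Fin m) (x : ℝ),
      (x * g' S x) * (psi α a x * phi α b x) =
        ∑ j ∈ S, (∏ s ∈ S, Function.update f j (eulerDeriv (f j)) s x) *
          (psi α a x * phi α b x) := by
    intro S a b x
    simp only [g']
    rw [Finset.mul_sum, Finset.sum_mul]
    refine Finset.sum_congr rfl fun j hj => ?_
    rw [prod_update_of_mem _ hj, eulerDeriv]
    ring
  have hparts := fun S => integral_euler_mul_psi_mul_phi hm hα (hg S) (hI S) fun a b => by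
    simp only [hg']
    exact integrable_finsetSum _ fun j _ => hIj j S a b
  have hI' := fun S : Finset (Fin l) => (hparts S).1
  -- the matrices
  set N := gramMatrix halfLine m (phi α) (psi α) fun (S : Finset (Fin l)) x => ∏ s ∈ S, f s x
    with hN
  have hN0 : N ∅ = 0 := by simp [hN, gramMatrix]
  let Mj : Fin l → Finset (Fin l) → ℝ := fun j S =>
    ∫ x, ∏ s ∈ S, linearStat m (Function.update f j (eulerDeriv (f j)) s) x ∂(ensemble m α)
  let M : Finset (Fin l) → ℝ := fun S => ∫ x, ∏ s ∈ S, linearStat m (f s) x ∂(ensemble m α)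
  have hMj : ∀ j T, j ∉ T → Mj j T = M T := by
    intro j T hj
    simp only [Mj, M]
    congr 1
    funext x
    refine Finset.prod_congr rfl fun s hs => ?_
    rw [Function.update_of_ne (fun h : s = j => hj (h ▸ hs))]
  have hM : ∀ S, sqfreeCoeff S (momentMatrix N).det = M S := by
    intro S
    rw [hN, momentMatrix_eq hα]
    exact (integral_prod_linearStat hα hI S).symm
  -- Entrywise, the product rule makes the sum over `j ∈ T` of the varied integrals equal to `∫ x (∏
  -- f_s)' psi_a phi_b`, which is the compressed commutator by parts.
  have hvar := IsVariation.det (G := momentMatrix N) (G' := momentMatrixDeriv (eulerMatrix m α) N)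
    (Gj := fun j => Matrix.of fun a b : Fin m => sqfreeSeries fun T =>
      ∫ x, (∏ s ∈ T, Function.update f j (eulerDeriv (f j)) s x) *
        (psi α a x * phi α b x) ∂halfLine) (by
    intro a b
    refine ⟨fun T j hj => ?_, fun T => ?_⟩
    · rw [hN, momentMatrix_eq hα]
      simp only [Matrix.of_apply, sqfreeCoeff_sqfreeSeries, prod_update_of_notMem _ hj]
    · simp only [Matrix.of_apply, sqfreeCoeff_sqfreeSeries]
      rw [sqfreeCoeff_momentMatrixDeriv]
      rcases T.eq_empty_or_nonempty with rfl | hT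
      · simp [hN0]
      · rw [← (hparts T).2 (N T) (fun a b => by simp [hN, gramMatrix, hT.ne_empty]) a b]
        simp only [hg']
        rw [integral_finsetSum _ fun j _ => hIj j T a b])
  have hM' : ∀ S, sqfreeCoeff S
      ((momentMatrix N).adjugate * momentMatrixDeriv (eulerMatrix m α) N).trace =
        ∑ j ∈ S, Mj j S := by
    intro S
    rw [hvar.eq_sum]
    refine Finset.sum_congr rfl fun j _ => ?_
    exact (integral_prod_linearStat hα (hIj j) S).symm
  have key := sum_moments_eq_sum_trace hN0 (eulerMatrix m α) hM hM'
  have hcard : ∀ π : Finpartition (Finset.univ : Finset (Fin l)),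
      Fintype.card π.parts = π.parts.card - 1 + 1 := by
    intro π
    have := parts_card_pos π
    rw [Fintype.card_coe]
    omega
  constructor
  · intro π σ hσ v
    obtain ⟨e, rfl, rfl⟩ := exists_cycleOf_eq (hcard π) hσ v
    exact (integral_decoupledIntegrand hm hα hI' π e).1
  · rw [decoupledIntegral]
    have h1 : ∀ π : Finpartition (Finset.univ : Finset (Fin l)), _ := fun π =>
      sum_isCycleOn (hcard π) fun σ v => ∫ x in Set.univ.pi fun _ : π.parts => Set.Ioi (0 : ℝ),
        decoupledIntegrand (kernel m α) (kernelD m α) f π σ v x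
    simp only [h1, (integral_decoupledIntegrand hm hα hI' _ _).2]
    -- The decoupled integral is now the matrix expansion; what remains is to match the scalar
    -- expansion with the cumulants, block by block.
    refine key.symm.trans ?_
    simp only [cumulantDeriv, cumulant, jointCumulant]
    rw [Finset.sum_comm]
    refine Finset.sum_congr rfl fun π _ => ?_
    rw [← Finset.mul_sum, ← mul_assoc]
    congr 1
    exact (sum_prod_parts hMj π).symm
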